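/- \textbf{Channel.} Let $\sigma>0$ and $n,t\in\mathbb N_0$. A random word $\boldsymbol c\in\mathbb F_2^n$ with arbitrary distribution is transmitted with BPSK ($0\mapsto+1$, $1\mapsto-1$) over an AWGN channel: $Y_i=X_i+Z_i$, with $Z_1,\dots,Z_n$ i.i.d. $\mathcal N(0,\sigma^2)$ and independent of $\boldsymbol c$. The log-likelihood ratios are $\ell_i=\frac{2}{\sigma^2}Y_i$ and the reliabilities are $\alpha_i=|\ell_i|$. The hard decision is $\hat y_i=1$ if $Y_i<0$ and $\hat y_i=0$ otherwise. All positions are rearranged so that $\alpha_1\le\dots\le\alpha_n$, and $\boldsymbol e=\boldsymbol c\oplus\hat{\boldsymbol y}$ is the error vector in this order. $\mathcal E_b$ is the event that $\boldsymbol e$ has Hamming weight $b$. \textbf{Pattern.} The logistic weight of $\boldsymbol u\in\mathbb F_2^n$ is $\sum_{i=1}^n i\,u_i$. The logistic weight pattern set of size $q$ consists of the $q$ vectors of $\mathbb F_2^n$ of smallest logistic weight, where ties are broken by smaller Hamming weight and then by smaller binary value $\sum_i 2^{i-1}u_i$. Let $\boldsymbol\rho\neq\boldsymbol 0$ belong to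 this set, let $w>0$ be its Hamming weight and $i^{\max}=\max\{i:\rho_i=1\}$. Put $b=t+w$ and assume $b\le n$. \textbf{Conditions.} Let $\beta_1\le\dots\le\beta_b$ and $\gamma_1\le\dots\le\gamma_{n-b}$ be symbols for the ordered reliabilities of the erroneous and of the correct positions. Symbols $\gamma_j$ with $j>n-b$ are read as $+\infty$. To a position $k\le i^{\max}$ assign $\beta_i$ with $i=|\{l\le k:\rho_l=1\}|$ if $\rho_k=1$, and $\gamma_j$ with $j=|\{l\le k:\rho_l=0\}|$ if $\rho_k=0$. Let $\mathcal F$ consist of the conditions - $u\le v$, for any two neighbouring positions $k,k+1\le i^{\max}$ with $\rho_k\ne\rho_{k+1}$ and assigned symbols $u$ and $v$, respectively; - $\beta_w\le\gamma_{i^{\max}-w+1}$. Let $\mathcal I_{\mathcal F}\subseteq\{1,\dots,b\}$ and $\mathcal J_{\mathcal F}\subseteq\{1,\dots,n-b\}$ be the sets of indices of the $\beta$'s and $\gamma$'s that occur in $\mathcal F$, and let $d_{\mathcal F}=|\mathcal I_{\mathcal F}|+|\mathcal J_{\mathcal F}|$. Let $\mathbb R^{d_{\mathcal F}}_{\ge0,\mathcal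 F}$ be the set of non-negative $(\boldsymbol x_{\mathcal I_{\mathcal F}},\boldsymbol y_{\mathcal J_{\mathcal F}})$ which fulfil $\mathcal F$ when $x_i$ and $y_j$ are substituted for $\beta_i$ and $\gamma_j$. \textbf{Densities.} Let $q_\sigma(x)=\frac1{\sqrt{2\pi\sigma^2}}e^{-x^2/(2\sigma^2)}$ and $Q_\sigma(x)=\int_x^\infty q_\sigma(s)\,ds$. For $x\ge0$ put $$f_{\mathrm e}(x)=\frac{q_\sigma(x+1)}{Q_\sigma(1)},\quad f_{\mathrm c}(x)=\frac{q_\sigma(x-1)}{1-Q_\sigma(1)},$$ $$F_{\mathrm e}(x)=\frac{Q_\sigma(1)-Q_\sigma(x+1)}{Q_\sigma(1)},\quad F_{\mathrm c}(x)=\frac{1-Q_\sigma(1)-Q_\sigma(x-1)}{1-Q_\sigma(1)},$$ and let all four functions be $0$ for $x<0$. These are the densities and distribution functions of $|Y_i|$ given a wrong and a correct hard decision, respectively. For $\mathcal I=\{i_1<\dots<i_\mu\}\subseteq\{1,\dots,m\}$, a density $f$ and its distribution function $F$, the joint density of the order statistics with indices in $\mathcal I$ of a sample of size $m$ is $$g^{f}_{m,\mathcal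 I}(\boldsymbol x)=m!\prod_{u\in\mathcal I}f(x_u)\prod_{l=0}^{\mu}\frac{[F(x_{i_{l+1}})-F(x_{i_l})]^{i_{l+1}-i_l-1}}{(i_{l+1}-i_l-1)!}\quad\text{if } x_{i_1}\le\dots\le x_{i_\mu},$$ and $0$ otherwise, with $i_0=0$, $i_{\mu+1}=m+1$, $F(x_{i_0})=F(0)$ and $F(x_{i_{\mu+1}})=F(\infty)=1$. Put $f_{\boldsymbol\beta_{b,\mathcal I}}=g^{f_{\mathrm e}}_{b,\mathcal I}$ and $f_{\boldsymbol\gamma_{n-b,\mathcal J}}=g^{f_{\mathrm c}}_{n-b,\mathcal J}$. \textbf{Claim.} $P(\mathcal E_{t+w})>0$, the integrand below is integrable on $\mathbb R^{d_{\mathcal F}}_{\ge0,\mathcal F}$, and $$P\big(e_i=\rho_i\text{ for all } i\le i^{\max}\,\big|\,\mathcal E_{t+w}\big)=\int_{\mathbb R^{d_{\mathcal F}}_{\ge0,\mathcal F}} f_{\boldsymbol\beta_{b,\mathcal I_{\mathcal F}}}(\boldsymbol x_{\mathcal I_{\mathcal F}})\,f_{\boldsymbol\gamma_{n-b,\mathcal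 J_{\mathcal F}}}(\boldsymbol y_{\mathcal J_{\mathcal F}})\,d\boldsymbol x_{\mathcal I_{\mathcal F}}\,d\boldsymbol y_{\mathcal J_{\mathcal F}}.$$ -/

import Mathlib

open MeasureTheory ProbabilityTheory Finset
open scoped Nat

noncomputable section

namespace ChaseOS

/-! ### Binary vectors

Vectors of length `n` are functions `Fin n → ZMod 2`; the index `i : Fin n` stands for the position
`i + 1 ∈ {1, …, n}`. The Hamming weight is Mathlib's `hammingNorm`. -/

/-- The largest position (in `{1, …, n}`) at which `u` is one; it is `0` for `u = 0`. -/
def maxPos {n : ℕ} (u : Fin n → ZMod 2) : ℕ :=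
  (univ.filter fun i => u i ≠ 0).sup fun i => (i : ℕ) + 1

/-- The logistic weight: the sum of the positions at which `u` is one. -/
def logisticWeight {n : ℕ} (u : Fin n → ZMod 2) : ℕ :=
  ∑ i : Fin n, ((i : ℕ) + 1) * (u i).val

/-- The number with binary representation `u`, position `1` being the least significant bit. -/
def binaryValue {n : ℕ} (u : Fin n → ZMod 2) : ℕ :=
  ∑ i : Fin n, 2 ^ (i : ℕ) * (u i).val

/-- The ranking of patterns: by logistic weight, then Hamming weight, then binary value. -/
def patternKey {n : ℕ} (u : Fin n → ZMod 2) : ℕ ×ₗ ℕ ×ₗ ℕ :=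
  toLex (logisticWeight u, toLex (hammingNorm u, binaryValue u))

/-- The logistic weight pattern set of cardinality `q` (for `q ≤ 2 ^ n`): the first `q` patterns in
the ranking. -/
def logisticPatterns (n q : ℕ) : Finset (Fin n → ZMod 2) :=
  univ.filter fun u => (univ.filter fun v : Fin n → ZMod 2 => patternKey v < patternKey u).card < q

/-! ### The channel -/

/-- BPSK modulation `0 ↦ +1`, `1 ↦ -1`. -/
def bpsk (c : ZMod 2) : ℝ := if c = 0 then 1 else -1

/-- The channel output `Y = X + Z` for the transmitted word `c` and the noise `z`. -/
def channelOutput {n : ℕ} (c : Fin n → ZMod 2) (z : Fin n → ℝ) : Fin n → ℝ :=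
  fun i => bpsk (c i) + z i

/-- The channel log-likelihood ratios. -/
def llr {n : ℕ} (σ : ℝ) (y : Fin n → ℝ) : Fin n → ℝ := fun i => 2 / σ ^ 2 * y i

/-- The reliabilities. -/
def reliability {n : ℕ} (σ : ℝ) (y : Fin n → ℝ) : Fin n → ℝ := fun i => |llr σ y i|

/-- The hard decision: one exactly where the channel output is negative. -/
def hardDecision {n : ℕ} (y : Fin n → ℝ) : Fin n → ZMod 2 := fun i => if y i < 0 then 1 else 0

/-- The error vector `c ⊕ ŷ`, after all positions have been rearranged in the order of
non-decreasing reliability. -/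
def errorVector {n : ℕ} (σ : ℝ) (c : Fin n → ZMod 2) (y : Fin n → ℝ) : Fin n → ZMod 2 :=
  fun i => (c + hardDecision y) (Tuple.sort (reliability σ y) i)

/-! ### Densities and distribution functions of `|Y|` given a wrong or a correct hard decision -/

/-- The density of the centred Gaussian with variance `σ ^ 2`. -/
def qσ (σ x : ℝ) : ℝ := 1 / √(2 * Real.pi * σ ^ 2) * Real.exp (-x ^ 2 / (2 * σ ^ 2))

/-- The tail of the centred Gaussian with variance `σ ^ 2`. -/
def tailQ (σ x : ℝ) : ℝ := ∫ s in Set.Ioi x, qσ σ s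

/-- Density given an erroneous hard decision. -/
def fe (σ x : ℝ) : ℝ := if 0 ≤ x then qσ σ (x + 1) / tailQ σ 1 else 0

/-- Density given a correct hard decision. -/
def fc (σ x : ℝ) : ℝ := if 0 ≤ x then qσ σ (x - 1) / (1 - tailQ σ 1) else 0

/-- Distribution function given an erroneous hard decision. -/
def Fe (σ x : ℝ) : ℝ := if 0 ≤ x then (tailQ σ 1 - tailQ σ (x + 1)) / tailQ σ 1 else 0

/-- Distribution function given a correct hard decision. -/
def Fc (σ x : ℝ) : ℝ :=
  if 0 ≤ x then (1 - tailQ σ 1 - tailQ σ (x - 1)) / (1 - tailQ σ 1) else 0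

/-! ### Joint densities of order statistics

`I = {i₁ < … < i_μ} ⊆ {1, …, m}` is the set of indices of the order statistics considered, out of a
sample of size `m` with density `f` and distribution function `F`. -/

/-- The indices `i₀ = 0`, `i₁ < … < i_μ`, `i_{μ+1} = m + 1`. -/
def osIndex (m : ℕ) (I : Finset ℕ) (l : ℕ) : ℕ :=
  if l = 0 then 0 else if h : l - 1 < I.card then I.orderEmbOfFin rfl ⟨l - 1, h⟩ else m + 1

/-- The values `F(x_{i_l})` for `l = 0, …, μ + 1`, with the conventions `x_{i₀} = 0` and
`x_{i_{μ+1}} = ∞`, `F(∞) = 1`. -/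
def osCDF (F : ℝ → ℝ) (I : Finset ℕ) (x : I → ℝ) (l : ℕ) : ℝ :=
  if l = 0 then F 0
  else if h : l - 1 < I.card then F (x (I.orderIsoOfFin rfl ⟨l - 1, h⟩)) else 1

open Classical in
/-- The joint density of the order statistics with indices in `I`, out of a sample of size `m`; it
is supported on the vectors `x_{i₁} ≤ … ≤ x_{i_μ}`. -/
def jointOSDensity (f F : ℝ → ℝ) (m : ℕ) (I : Finset ℕ) (x : I → ℝ) : ℝ :=
  if Monotone x then
    (m ! : ℝ) * (∏ u : I, f (x u)) *
      ∏ l ∈ range (I.card + 1),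
        (osCDF F I x (l + 1) - osCDF F I x l) ^ (osIndex m I (l + 1) - osIndex m I l - 1) /
          ((osIndex m I (l + 1) - osIndex m I l - 1)! : ℝ)
  else 0

/-! ### The order constraints of a pattern -/

/-- The symbols `β_i` (the `i`-th smallest reliability at an erroneous position) and `γ_j` (the
`j`-th smallest reliability at a correct position), `i, j ≥ 1`. -/
inductive OSVar where
  | beta (i : ℕ)
  | gamma (j : ℕ)
  deriving DecidableEq

/-- The order statistic found at a position, if the errors up to there are those of `ρ`. -/
def varAt {n : ℕ} (ρ : Fin n → ZMod 2) (k : Fin n) : OSVar :=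
  if ρ k ≠ 0 then .beta (univ.filter fun i => i ≤ k ∧ ρ i ≠ 0).card
  else .gamma (univ.filter fun i => i ≤ k ∧ ρ i = 0).card

/-- The conditions `F`, a pair `(u, v)` standing for `u ≤ v`: one for each two neighbouring
positions `k, k + 1 ≤ i_max` whose entries differ (equal entries give a trivial condition), and
`β_w ≤ γ_{i_max - w + 1}`. -/
def constraints {n : ℕ} (ρ : Fin n → ZMod 2) : Finset (OSVar × OSVar) :=
  insert (.beta (hammingNorm ρ), .gamma (maxPos ρ - hammingNorm ρ + 1))
    ((univ.filter fun p : Fin n × Fin n =>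
        (p.1 : ℕ) + 1 = p.2 ∧ (p.2 : ℕ) + 1 ≤ maxPos ρ ∧ ρ p.1 ≠ ρ p.2).image
      fun p => (varAt ρ p.1, varAt ρ p.2))

/-- The indices in `{1, …, b}` of the `β`s that occur in the conditions. -/
def betaIdx {n : ℕ} (ρ : Fin n → ZMod 2) (b : ℕ) : Finset ℕ :=
  (Icc 1 b).filter fun i => ∃ p ∈ constraints ρ, p.1 = .beta i ∨ p.2 = .beta i

/-- The indices in `{1, …, m}` of the `γ`s that occur in the conditions. -/
def gammaIdx {n : ℕ} (ρ : Fin n → ZMod 2) (m : ℕ) : Finset ℕ :=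
  (Icc 1 m).filter fun j => ∃ p ∈ constraints ρ, p.1 = .gamma j ∨ p.2 = .gamma j

/-- The value of a symbol. An order statistic whose index exceeds the sample size is `+∞`. -/
def OSVar.value {I J : Finset ℕ} (x : I → ℝ) (y : J → ℝ) : OSVar → EReal
  | .beta i => if h : i ∈ I then ((x ⟨i, h⟩ : ℝ) : EReal) else ⊤
  | .gamma j => if h : j ∈ J then ((y ⟨j, h⟩ : ℝ) : EReal) else ⊤

/-- The non-negative vectors `(x, y)` that fulfil the conditions. -/
def region {n : ℕ} (ρ : Fin n → ZMod 2) (b m : ℕ) :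
    Set ((betaIdx ρ b → ℝ) × (gammaIdx ρ m → ℝ)) :=
  {p | 0 ≤ p.1 ∧ 0 ≤ p.2 ∧
    ∀ c ∈ constraints ρ, c.1.value p.1 p.2 ≤ c.2.value p.1 p.2}

end ChaseOS

end

/-! Multiplying the channel output by the transmitted symbols gives `V i = 1 + X i * Z i`. Its
entries are i.i.d. `N(1, σ²)` whatever the law of the word, `|V i| = |Y i|`, and almost surely
position `i` is wrong exactly when `V i < 0` (`map_alignedOutput`, `errorVector_apply`). The claim
thus concerns the signs and the absolute values of an i.i.d. Gaussian vector.

For a fixed set `S` of `b` positions, consider the event that `S` is the set of negative entries and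
that the absolute values on and off `S` lie in `A`. Its probability is `Q(1)^b (1 - Q(1))^(n-b)`
times the probability of `A` for independent samples of sizes `b` and `n - b` with densities `fe`
and `fc` (`gaussian_measure_negSet`). This does not depend on the choice of `S`; summing over `S`
and dividing by the probability of weight `b` leaves exactly the law of the two samples, `relLaw`.

A deterministic argument follows: the sorted reliabilities are the merge of the sorted `β` and `γ`,
and the merge starts like `ρ` if and only if the conditions hold (`IsMerge.mem_region_iff`). One
direction only compares consecutive entries. Conversely, the conditions make the symbol assigned to
a position at least as large as every `β` and `γ` used so far and at most as large as the next one
of either kind. As there are no ties, its rank is that position.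

It remains to find the joint density of the chosen order statistics (`HasDensityCDF.map_orderStat`).
By symmetry their law is `m!` times the law restricted to increasing samples. Dropping the
comparisons between unchosen entries of the same gap enlarges the set of increasing samples by the
product of the gap factorials. The measure of the larger set follows from Fubini: given the chosen
entries, the others fall into their gaps independently. -/

noncomputable section

namespace ChaseOS

/-! ### Product measures with densities -/

/-- A power of a measure with a real density has the product density. -/
theorem pi_withDensity_ofReal {ι : Type*} [Fintype ι] {f : ℝ → ℝ} (hf : Integrable f)
    (hf0 : ∀ x, 0 ≤ f x) :
    Measure.pi (fun _ : ι => (volume : Measure ℝ).withDensity fun x => ENNReal.ofReal (f x)) =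
      (volume : Measure (ι → ℝ)).withDensity fun x => ENNReal.ofReal (∏ i, f (x i)) := by
  have := isFiniteMeasure_withDensity_ofReal hf.2
  refine Measure.pi_eq fun s hs => ?_
  rw [withDensity_apply _ (MeasurableSet.univ_pi hs), volume_pi, Measure.restrict_pi_pi]
  rw [← ofReal_integral_eq_lintegral_ofReal, integral_fintype_prod_eq_prod (fun _ => f),
    ENNReal.ofReal_prod_of_nonneg]
  · refine Finset.prod_congr rfl fun i _ => ?_
    rw [withDensity_apply _ (hs i), ofReal_integral_eq_lintegral_ofReal hf.integrableOn
      (Filter.Eventually.of_forall hf0)]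
  · exact fun i _ => integral_nonneg hf0
  · exact Integrable.fintype_prod fun i => hf.integrableOn
  · exact Filter.Eventually.of_forall fun x => Finset.prod_nonneg fun i _ => hf0 _

/-- Each exceptional set is a proper linear subspace, hence null. The values `c = 1` and `c = -1`
together exclude coinciding absolute values. -/
theorem ae_add_mul_ne_zero {ι : Type*} [Fintype ι] (c : ℝ) :
    ∀ᵐ x : ι → ℝ, ∀ i j, i ≠ j → x i + c * x j ≠ 0 := by
  classical
  refine ae_all_iff.2 fun i => ae_all_iff.2 fun j => ?_
  by_cases h : i = j
  · simp [h]
  let L : (ι → ℝ) →ₗ[ℝ] ℝ :=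
    { toFun := fun x => x i + c * x j
      map_add' := fun x y => by simp only [Pi.add_apply]; ring
      map_smul' := fun r x => by simp only [Pi.smul_apply, smul_eq_mul, RingHom.id_apply]; ring }
  have hL : LinearMap.ker L ≠ ⊤ := fun h0 => by
    have h1 : L (Pi.single i 1) = 0 := by rw [LinearMap.ker_eq_top.1 h0]; rfl
    have h2 : L (Pi.single i 1) = 1 := by
      change (Pi.single i 1 : ι → ℝ) i + c * (Pi.single i 1 : ι → ℝ) j = 1
      simp [Ne.symm h]
    exact one_ne_zero (h2.symm.trans h1)
  filter_upwards [compl_mem_ae_iff.2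
    (Measure.addHaar_submodule (volume : Measure (ι → ℝ)) (LinearMap.ker L) hL)] with x hx _ h'
  exact hx h'

/-- Almost every vector has entries with pairwise distinct absolute values. -/
theorem ae_injective_abs {ι : Type*} [Fintype ι] :
    ∀ᵐ x : ι → ℝ, Function.Injective fun i => |x i| := by
  filter_upwards [ae_add_mul_ne_zero 1, ae_add_mul_ne_zero (-1)] with x h1 h2 i j hij
  by_contra h
  rcases abs_eq_abs.1 hij with h' | h'
  · exact h2 i j h (by rw [h']; ring)
  · exact h1 i j h (by rw [h']; ring)

/-- Almost every vector has pairwise distinct entries. -/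
theorem ae_injective {ι : Type*} [Fintype ι] :
    ∀ᵐ x : ι → ℝ, Function.Injective x := by
  filter_upwards [ae_injective_abs] with x hx
  exact Function.Injective.of_comp (f := fun t : ℝ => |t|) hx

theorem ae_ne_zero {ι : Type*} [Fintype ι] : ∀ᵐ x : ι → ℝ, ∀ i, x i ≠ 0 :=
  ae_all_iff.2 fun i => Measure.ae_eval_ne (fun _ : ι => (volume : Measure ℝ)) i 0

theorem pi_smul_const {ι : Type*} [Fintype ι] (μ : Measure ℝ) [IsProbabilityMeasure μ]
    {c : ENNReal} (hc : c ≠ ⊤) :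
    Measure.pi (fun _ : ι => c • μ) = c ^ Fintype.card ι • Measure.pi (fun _ : ι => μ) := by
  have : IsFiniteMeasure (c • μ) := Measure.smul_finite μ hc
  refine Measure.pi_eq fun s hs => ?_
  simp [Finset.prod_mul_distrib]

/-! ### Order statistics of independent samples -/

/-- The `k`-th smallest entry of `x` (counting from `0`). -/
def orderStat {m : ℕ} (x : Fin m → ℝ) (k : Fin m) : ℝ := x (Tuple.sort x k)

theorem sort_eq_of_strictMono_comp {m : ℕ} {x : Fin m → ℝ} {π : Equiv.Perm (Fin m)}
    (h : StrictMono (x ∘ π)) : Tuple.sort x = π := by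
  have hinj : Function.Injective x := by
    have := h.injective.comp π.symm.injective
    simpa [Function.comp_assoc] using this
  have := Tuple.unique_monotone (Tuple.monotone_sort x) h.monotone
  ext k
  exact congrArg Fin.val (hinj (congrFun this k))

theorem strictMono_comp_sort {m : ℕ} {x : Fin m → ℝ} (h : Function.Injective x) :
    StrictMono (x ∘ Tuple.sort x) :=
  (Tuple.monotone_sort x).strictMono_of_injective (h.comp (Tuple.sort x).injective)

theorem measurableSet_setOf_strictMono {ι : Type*} [Fintype ι] [Preorder ι] :
    MeasurableSet {x : ι → ℝ | StrictMono x} := by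
  have : {x : ι → ℝ | StrictMono x} = ⋂ i, ⋂ j, {x | i < j → x i < x j} := by
    ext x; simp [StrictMono]
  rw [this]
  refine MeasurableSet.iInter fun i => MeasurableSet.iInter fun j => ?_
  by_cases h : i < j
  · simpa [h] using measurableSet_lt (measurable_pi_apply i) (measurable_pi_apply j)
  · simp [h]

/-- `Tuple.sort` breaks ties by position, so the event is a finite conjunction of comparisons
between coordinates. -/
theorem measurableSet_setOf_sort_eq {m : ℕ} (π : Equiv.Perm (Fin m)) :
    MeasurableSet {x : Fin m → ℝ | Tuple.sort x = π} := by
  have : {x : Fin m → ℝ | Tuple.sort x = π} = ⋂ i, ⋂ j,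
      {x | (i ≤ j → x (π i) ≤ x (π j)) ∧ (i < j → x (π i) = x (π j) → π i < π j)} := by
    ext x
    simp only [Set.mem_ofPred_eq, Set.mem_iInter]
    rw [eq_comm, Tuple.eq_sort_iff]
    simp only [Monotone, Function.comp]
    grind
  rw [this]
  refine MeasurableSet.iInter fun i => MeasurableSet.iInter fun j => ?_
  have h1 : MeasurableSet {x : Fin m → ℝ | x (π i) ≤ x (π j)} :=
    measurableSet_le (measurable_pi_apply _) (measurable_pi_apply _)
  have h2 : MeasurableSet {x : Fin m → ℝ | x (π i) = x (π j)} :=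
    measurableSet_eq_fun (measurable_pi_apply _) (measurable_pi_apply _)
  exact ((MeasurableSet.const _).imp h1).inter
    ((MeasurableSet.const _).imp (h2.imp (MeasurableSet.const _)))

theorem measurable_orderStat {m : ℕ} (k : Fin m) :
    Measurable fun x : Fin m → ℝ => orderStat x k := by
  intro s hs
  have : (fun x : Fin m → ℝ => orderStat x k) ⁻¹' s =
      ⋃ π : Equiv.Perm (Fin m), {x | Tuple.sort x = π} ∩ (fun x => x (π k)) ⁻¹' s := by
    ext x; simp [orderStat]
  rw [this]
  exact MeasurableSet.iUnion fun π =>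
    (measurableSet_setOf_sort_eq π).inter (measurable_pi_apply (π k) hs)

/-- Powers of a measure are invariant under reindexing. -/
theorem measurePreserving_reindex {ι ι' : Type*} [Fintype ι] [Fintype ι'] (μ : Measure ℝ)
    [SigmaFinite μ] (e : ι ≃ ι') :
    MeasurePreserving (fun (x : ι' → ℝ) i => x (e i)) (Measure.pi fun _ => μ)
      (Measure.pi fun _ => μ) := by
  have hm : Measurable fun (x : ι' → ℝ) i => x (e i) :=
    measurable_pi_lambda _ fun i => measurable_pi_apply _
  refine ⟨hm, (Measure.pi_eq fun s hs => ?_).symm⟩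
  rw [Measure.map_apply hm (MeasurableSet.univ_pi hs)]
  have : (fun (x : ι' → ℝ) i => x (e i)) ⁻¹' Set.univ.pi s =
      Set.univ.pi fun i => s (e.symm i) := by
    ext x
    simp only [Set.mem_preimage, Set.mem_univ_pi]
    exact ⟨fun h i => by simpa using h (e.symm i), fun h i => by simpa using h (e i)⟩
  rw [this, Measure.pi_pi]
  exact (Fintype.prod_equiv e _ _ fun i => by simp).symm

/-- If `G` is, up to vectors with repeated entries, the disjoint union over `π ∈ K` of
`{x | x ∘ π ∈ T}`, with `T` consisting of increasing vectors, then its measure is `#K` times the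
measure of `T`. -/
theorem pi_measure_eq_card_mul {m : ℕ} (μ : Measure ℝ) [SigmaFinite μ]
    (hμ : ∀ᵐ x ∂Measure.pi fun _ : Fin m => μ, Function.Injective x)
    (K : Finset (Equiv.Perm (Fin m))) {G T : Set (Fin m → ℝ)} (hT : MeasurableSet T)
    (hTs : ∀ x ∈ T, StrictMono x)
    (hG : ∀ x ∈ G, Function.Injective x → Tuple.sort x ∈ K)
    (hGT : ∀ x, ∀ π ∈ K, StrictMono (x ∘ π) → (x ∈ G ↔ x ∘ π ∈ T)) :
    (Measure.pi fun _ : Fin m => μ) G = K.card * (Measure.pi fun _ : Fin m => μ) T := by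
  -- A vector without repeated entries belongs to the piece of its sorting permutation and to no
  -- other. All pieces have the measure of `T`, since the product measure is invariant under
  -- permutations of the coordinates.
  have hae : G =ᵐ[Measure.pi fun _ : Fin m => μ] ⋃ π ∈ K, {x | x ∘ π ∈ T} := by
    filter_upwards [hμ] with x hx
    refine propext ?_
    change x ∈ G ↔ x ∈ ⋃ π ∈ K, {x | x ∘ π ∈ T}
    simp only [Set.mem_iUnion, Set.mem_ofPred_eq, exists_prop]
    constructor
    · intro h
      exact ⟨_, hG x h hx, (hGT x _ (hG x h hx) (strictMono_comp_sort hx)).1 h⟩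
    · rintro ⟨π, hπ, h⟩
      exact (hGT x π hπ (hTs _ h)).2 h
  have hpre : ∀ π : Equiv.Perm (Fin m), MeasurableSet {x : Fin m → ℝ | x ∘ π ∈ T} ∧
      (Measure.pi fun _ : Fin m => μ) {x | x ∘ π ∈ T} = (Measure.pi fun _ : Fin m => μ) T :=
    fun π => ⟨(measurePreserving_reindex μ π).measurable hT,
      (measurePreserving_reindex μ π).measure_preimage hT.nullMeasurableSet⟩
  rw [measure_congr hae, measure_biUnion_finset]
  · simp [hpre]
  · intro π _ π' _ hne
    refine Set.disjoint_left.2 fun x hx hx' => hne ?_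
    exact (sort_eq_of_strictMono_comp (hTs _ hx)).symm.trans
      (sort_eq_of_strictMono_comp (hTs _ hx'))
  · exact fun π _ => (hpre π).1

theorem pi_measure_sorted_mem {m : ℕ} (μ : Measure ℝ) [SigmaFinite μ]
    (hμ : ∀ᵐ x ∂Measure.pi fun _ : Fin m => μ, Function.Injective x)
    {D : Set (Fin m → ℝ)} (hD : MeasurableSet D) :
    (Measure.pi fun _ : Fin m => μ) {x | orderStat x ∈ D} =
      (m ! : ENNReal) * (Measure.pi fun _ : Fin m => μ) {x | StrictMono x ∧ x ∈ D} := by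
  rw [pi_measure_eq_card_mul μ hμ univ (measurableSet_setOf_strictMono.inter hD)
    (fun x hx => hx.1) (fun x _ _ => mem_univ _)]
  · rw [card_univ, Fintype.card_perm, Fintype.card_fin]; rfl
  · intro x π _ hx
    have : orderStat x = x ∘ π := by
      rw [← sort_eq_of_strictMono_comp hx]; rfl
    change orderStat x ∈ D ↔ StrictMono (x ∘ π) ∧ x ∘ π ∈ D
    rw [this]
    simp [hx]

/-! ### Counting indices -/

/-- The number of indices in `I` that are at most `k`. -/
def idxCount (I : Finset ℕ) (k : ℕ) : ℕ := (I.filter (· ≤ k)).card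

theorem idxCount_succ (I : Finset ℕ) (k : ℕ) :
    idxCount I (k + 1) = idxCount I k + if k + 1 ∈ I then 1 else 0 := by
  unfold idxCount
  split_ifs with h
  · have : I.filter (· ≤ k + 1) = insert (k + 1) (I.filter (· ≤ k)) := by
      ext i; simp only [mem_filter, mem_insert]; grind
    rw [this, card_insert_of_notMem (by simp)]
  · have : I.filter (· ≤ k + 1) = I.filter (· ≤ k) := by
      ext i; simp only [mem_filter]; grind
    rw [this, add_zero]

theorem idxCount_mono (I : Finset ℕ) : Monotone (idxCount I) := fun _ _ h =>
  card_le_card (monotone_filter_right I fun _ _ hi => hi.trans h)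

theorem idxCount_lt_iff (I : Finset ℕ) {j k : ℕ} :
    idxCount I j < idxCount I k ↔ ∃ i ∈ I, j < i ∧ i ≤ k := by
  constructor
  · intro h
    by_contra! h'
    refine h.not_ge (card_le_card fun i => ?_)
    simp only [mem_filter]
    grind
  · rintro ⟨i, hi, hji, hik⟩
    refine card_lt_card (ssubset_iff.2 ⟨i, by simp [hji], ?_⟩)
    intro l
    simp only [mem_insert, mem_filter]
    grind

theorem idxCount_le_card (I : Finset ℕ) (k : ℕ) : idxCount I k ≤ I.card :=
  card_le_card (filter_subset _ _)

theorem lt_idxCount_iff (I : Finset ℕ) (k : ℕ) (j : Fin I.card) :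
    (j : ℕ) < idxCount I k ↔ I.orderEmbOfFin rfl j ≤ k := by
  rw [← Tuple.lt_card_le_iff_apply_le_of_monotone (I.orderEmbOfFin rfl).monotone]
  have : idxCount I k = #{i | I.orderEmbOfFin rfl i ≤ k} := by
    unfold idxCount
    conv_lhs => rw [← Finset.image_orderEmbOfFin_univ I rfl]
    rw [filter_image, card_image_of_injective _ (I.orderEmbOfFin rfl).injective]
  rw [this]

theorem osIndex_succ_of_lt (m : ℕ) {I : Finset ℕ} {l : ℕ} (h : l < I.card) :
    osIndex m I (l + 1) = I.orderEmbOfFin rfl ⟨l, h⟩ := by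
  simp [osIndex, h]

theorem osIndex_succ_of_le (m : ℕ) {I : Finset ℕ} {l : ℕ} (h : I.card ≤ l) :
    osIndex m I (l + 1) = m + 1 := by
  simp [osIndex, h.not_gt]

/-- The number of indices strictly between two consecutive elements of `I`. -/
theorem card_gap {m : ℕ} {I : Finset ℕ} (hI : I ⊆ Icc 1 m) {l : ℕ} (hl : l ≤ I.card) :
    (univ.filter fun k : Fin m => (k : ℕ) + 1 ∉ I ∧ idxCount I k = l).card =
      osIndex m I (l + 1) - osIndex m I l - 1 := by
  -- Position `k` carries the index `k + 1`, which is in gap `l` when it lies strictly between `i_l`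
  -- and `i_{l+1}`. The lower bound is `hlow`; the upper one is `hupp` together with `hne`, which
  -- excludes equality.
  have hlow : ∀ k, osIndex m I l < k + 1 ↔ l ≤ idxCount I k := by
    intro k
    rcases l with _ | l
    · simp [osIndex]
    · rw [osIndex_succ_of_lt m hl, Nat.lt_succ_iff, ← lt_idxCount_iff, Nat.succ_le_iff]
  have hupp : ∀ k, k < m → (k < osIndex m I (l + 1) ↔ idxCount I k ≤ l) := by
    intro k hk
    rcases lt_or_ge l I.card with h | h
    · rw [osIndex_succ_of_lt m h, ← not_le, ← lt_idxCount_iff, not_lt]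
    · rw [osIndex_succ_of_le m h]
      exact ⟨fun _ => (idxCount_le_card I k).trans h, fun _ => by omega⟩
  have hne : ∀ k, k + 1 ∉ I → k < m → k + 1 ≠ osIndex m I (l + 1) := by
    intro k hk hkm heq
    rcases lt_or_ge l I.card with h | h
    · rw [osIndex_succ_of_lt m h] at heq
      exact hk (heq ▸ I.orderEmbOfFin_mem rfl _)
    · rw [osIndex_succ_of_le m h] at heq
      omega
  have hmem : ∀ k, k + 1 ∈ I → k + 1 < osIndex m I (l + 1) → idxCount I k < l := by
    intro k hk hlt
    have h2 := idxCount_succ I k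
    rw [if_pos hk] at h2
    rcases lt_or_ge l I.card with h | h
    · rw [osIndex_succ_of_lt m h, ← not_le, ← lt_idxCount_iff, not_lt] at hlt
      simp only at hlt
      omega
    · have := idxCount_le_card I (k + 1)
      have := h.antisymm hl
      omega
  have htop : osIndex m I (l + 1) ≤ m + 1 := by
    rcases lt_or_ge l I.card with h | h
    · rw [osIndex_succ_of_lt m h]
      have := mem_Icc.1 (hI (I.orderEmbOfFin_mem rfl ⟨l, h⟩))
      omega
    · rw [osIndex_succ_of_le m h]
  rw [← Nat.card_Ioo]
  refine card_bij (fun k _ => (k : ℕ) + 1) ?_ (fun a _ b _ h => Fin.ext (by omega)) ?_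
  · intro k hk
    obtain ⟨hkI, hkl⟩ := (mem_filter.1 hk).2
    rw [mem_Ioo, hlow]
    have := (hupp k k.2).2 hkl.le
    have := hne k hkI k.2
    omega
  · intro K hK
    obtain ⟨h1, h2⟩ := mem_Ioo.1 hK
    obtain ⟨k, rfl⟩ : ∃ k, K = k + 1 := ⟨K - 1, by omega⟩
    refine ⟨⟨k, by omega⟩, ?_, rfl⟩
    simp only [mem_filter, mem_univ, true_and]
    have h3 := (hlow k).1 h1
    have h4 := (hupp k (by omega)).1 (by omega)
    refine ⟨fun h => ?_, by omega⟩
    have := hmem k h h2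
    omega

/-! ### Permutations preserving the gaps between the chosen indices -/

/-- A weakly increasing colouring of the positions `k = 0, …, m - 1`: the positions of the indices
in `I` get distinct odd colours, the positions in a gap between them share an even colour. -/
def gapColor (m : ℕ) (I : Finset ℕ) (k : Fin m) : ℕ := idxCount I k + idxCount I (k + 1)

theorem gapColor_mono (m : ℕ) (I : Finset ℕ) : Monotone (gapColor m I) := fun j k h =>
  add_le_add (idxCount_mono I (by exact_mod_cast h))
    (idxCount_mono I (Nat.succ_le_succ (by exact_mod_cast h)))

theorem gapColor_eq_even_iff {m : ℕ} {I : Finset ℕ} {k : Fin m} {l : ℕ} :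
    gapColor m I k = 2 * l ↔ (k : ℕ) + 1 ∉ I ∧ idxCount I k = l := by
  unfold gapColor
  rw [idxCount_succ]
  split_ifs with h <;> simp [h] <;> omega

theorem gapColor_eq_odd_iff {m : ℕ} {I : Finset ℕ} {k : Fin m} {l : ℕ} :
    gapColor m I k = 2 * l + 1 ↔ (k : ℕ) + 1 ∈ I ∧ idxCount I k = l := by
  unfold gapColor
  rw [idxCount_succ]
  split_ifs with h <;> simp [h] <;> omega

theorem gapColor_lt_iff {m : ℕ} {I : Finset ℕ} {j k : Fin m} :
    gapColor m I j < gapColor m I k ↔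
      j < k ∧ ((j : ℕ) + 1 ∈ I ∨ (k : ℕ) + 1 ∈ I ∨ ∃ i ∈ I, (j : ℕ) + 1 < i ∧ i < (k : ℕ) + 1) := by
  constructor
  · intro h
    have hjk : j < k := not_le.1 fun h' => (gapColor_mono m I h').not_gt h
    refine ⟨hjk, ?_⟩
    have hjk' : (j : ℕ) < k := hjk
    have : idxCount I j < idxCount I (k + 1) := by
      have h1 := idxCount_mono I (show (j : ℕ) ≤ j + 1 by omega)
      have h2 := idxCount_mono I (show (k : ℕ) ≤ k + 1 by omega)
      unfold gapColor at h
      omega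
    obtain ⟨i, hi, h1, h2⟩ := (idxCount_lt_iff I).1 this
    by_cases h3 : i = j + 1
    · exact Or.inl (h3 ▸ hi)
    by_cases h4 : i = k + 1
    · exact Or.inr (Or.inl (h4 ▸ hi))
    exact Or.inr (Or.inr ⟨i, hi, by omega, by omega⟩)
  · rintro ⟨hjk, h⟩
    have hjk' : (j : ℕ) < k := hjk
    unfold gapColor
    have h1 := idxCount_mono I (show (j : ℕ) ≤ k by omega)
    have h2 := idxCount_mono I (show (j : ℕ) + 1 ≤ k + 1 by omega)
    rcases h with h | h | ⟨i, hi, h3, h4⟩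
    · have := (idxCount_lt_iff I (j := j) (k := k)).2 ⟨_, h, by omega, by omega⟩
      omega
    · have := (idxCount_lt_iff I (j := j + 1) (k := k + 1)).2 ⟨_, h, by omega, by omega⟩
      omega
    · have := (idxCount_lt_iff I (j := j) (k := k)).2 ⟨i, hi, by omega, by omega⟩
      omega

theorem gapColor_injOn {m : ℕ} {I : Finset ℕ} {j k : Fin m} (hj : (j : ℕ) + 1 ∈ I)
    (h : gapColor m I k = gapColor m I j) : k = j := by
  rcases lt_trichotomy k j with hlt | heq | hlt
  · exact absurd h (gapColor_lt_iff.2 ⟨hlt, Or.inr (Or.inl hj)⟩).ne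
  · exact heq
  · exact absurd h (gapColor_lt_iff.2 ⟨hlt, Or.inl hj⟩).ne'

theorem prod_range_two_mul {M : Type*} [CommMonoid M] (g : ℕ → M) (hg : ∀ l, g (2 * l + 1) = 1)
    (N : ℕ) : ∏ c ∈ range (2 * N), g c = ∏ l ∈ range N, g (2 * l) := by
  induction N with
  | zero => simp
  | succ N ih => rw [Nat.mul_succ, prod_range_succ, prod_range_succ, ih, hg, mul_one,
      prod_range_succ]

/-- The permutations preserving the colouring. -/
def gapPerms (m : ℕ) (I : Finset ℕ) : Finset (Equiv.Perm (Fin m)) :=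
  univ.filter fun π => gapColor m I ∘ π = gapColor m I

/-- The stabiliser of a colouring has as many elements as the product of the factorials of the sizes
of the colour classes. Odd classes have at most one element and contribute `1`; the class of colour
`2 * l` is the `l`-th gap. -/
theorem card_gapPerms {m : ℕ} {I : Finset ℕ} (hI : I ⊆ Icc 1 m) :
    (gapPerms m I).card =
      ∏ l ∈ range (I.card + 1), (osIndex m I (l + 1) - osIndex m I l - 1)! := by
  have h1 : (gapPerms m I).card =
      ∏ c ∈ univ.image (gapColor m I), (univ.filter fun k => gapColor m I k = c).card ! := by
    rw [gapPerms, ← Fintype.card_subtype, DomMulAct.stabilizer_card']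
    exact prod_congr rfl fun c _ => by rw [Fintype.card_subtype]
  rw [h1, prod_subset (s₂ := range (2 * (I.card + 1))), prod_range_two_mul]
  · refine prod_congr rfl fun l hl => ?_
    rw [← card_gap hI (Nat.lt_succ_iff.1 (mem_range.1 hl))]
    simp only [gapColor_eq_even_iff]
  · intro l
    refine Nat.factorial_eq_one.2 (card_le_one.2 fun j hj k hk => ?_)
    rw [mem_filter] at hj hk
    exact gapColor_injOn (gapColor_eq_odd_iff.1 hk.2).1 (hj.2.trans hk.2.symm)
  · intro c hc
    obtain ⟨k, -, rfl⟩ := mem_image.1 hc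
    have h1 := idxCount_succ I k
    have h2 := idxCount_le_card I (k + 1)
    have h3 := idxCount_le_card I k
    rw [mem_range]
    unfold gapColor
    split_ifs at h1 <;> omega
  · intro c _ hc
    rw [filter_false_of_mem, card_empty, Nat.factorial_zero]
    exact fun k _ h => hc (mem_image.2 ⟨k, mem_univ k, h⟩)

/-- The position of an index `i ∈ I ⊆ {1, …, m}`. -/
def idxPos {m : ℕ} {I : Finset ℕ} (hI : I ⊆ Icc 1 m) (i : I) : Fin m :=
  ⟨i - 1, by have := mem_Icc.1 (hI i.2); omega⟩

theorem idxPos_add_one {m : ℕ} {I : Finset ℕ} (hI : I ⊆ Icc 1 m) (i : I) :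
    (idxPos hI i : ℕ) + 1 = i := by
  have := mem_Icc.1 (hI i.2)
  simp only [idxPos]; omega

/-- The vectors whose entries are ordered relative to the entries at the chosen positions. -/
def gapOrdered {m : ℕ} {I : Finset ℕ} (hI : I ⊆ Icc 1 m) (B : Set (I → ℝ)) : Set (Fin m → ℝ) :=
  {x | (fun i => x (idxPos hI i)) ∈ B ∧ ∀ j k, gapColor m I j < gapColor m I k → x j < x k}

/-- The vectors of `gapOrdered` without repeated entries are those that become increasing after
permuting entries inside the gaps; such a permutation moves no chosen entry, so the condition `B` is
unaffected. -/
theorem pi_measure_gapOrdered {m : ℕ} {I : Finset ℕ} (hI : I ⊆ Icc 1 m) (μ : Measure ℝ)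
    [SigmaFinite μ] (hμ : ∀ᵐ x ∂Measure.pi fun _ : Fin m => μ, Function.Injective x)
    {B : Set (I → ℝ)} (hB : MeasurableSet B) :
    (Measure.pi fun _ : Fin m => μ) (gapOrdered hI B) = (gapPerms m I).card *
      (Measure.pi fun _ : Fin m => μ) {x | StrictMono x ∧ (fun i => x (idxPos hI i)) ∈ B} := by
  have hproj : Measurable fun (x : Fin m → ℝ) i => x (idxPos hI i) :=
    measurable_pi_lambda _ fun i => measurable_pi_apply _
  refine pi_measure_eq_card_mul μ hμ _ (measurableSet_setOf_strictMono.inter (hproj hB))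
    (fun x hx => hx.1) ?_ ?_
  · intro x hx hinj
    refine mem_filter.2 ⟨mem_univ _, ?_⟩
    -- Entries of smaller colour are smaller, so sorting `x` also sorts the colours. They were
    -- sorted already, hence the sorting permutation preserves them.
    have h : Monotone (gapColor m I ∘ Tuple.sort x) := fun a b hab =>
      not_lt.1 fun h => (hx.2 _ _ h).not_ge (Tuple.monotone_sort x hab)
    exact Tuple.unique_monotone (τ := 1) h (gapColor_mono m I)
  · intro x π hπ hx
    have hπ' : ∀ k, gapColor m I (π k) = gapColor m I k := fun k =>
      congrFun (mem_filter.1 hπ).2 k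
    have hfix : ∀ i, π (idxPos hI i) = idxPos hI i := fun i =>
      gapColor_injOn (by rw [idxPos_add_one]; exact i.2) (hπ' _)
    change (_ ∧ _) ↔ StrictMono (x ∘ π) ∧ (fun i => x (π (idxPos hI i))) ∈ B
    simp only [hfix, hx, true_and]
    refine and_iff_left fun j k hjk => ?_
    have h1 : π.symm j < π.symm k := not_le.1 fun h => by
      have := gapColor_mono m I h
      rw [← hπ', ← hπ' (π.symm j)] at this
      simp only [Equiv.apply_symm_apply] at this
      omega
    simpa using hx h1

/-! ### The joint density -/

/-- `f` is the density and `F` the distribution function of the probability measure `μ` on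
`[0, ∞)`. -/
structure HasDensityCDF (μ : Measure ℝ) (f F : ℝ → ℝ) : Prop where
  prob : IsProbabilityMeasure μ
  measurable : Measurable f
  nonneg : ∀ x, 0 ≤ f x
  integrable : Integrable f
  eq_withDensity : μ = volume.withDensity fun x => ENNReal.ofReal (f x)
  cdf_nonneg : ∀ x, 0 ≤ F x
  cdf_zero : F 0 = 0
  measure_Iic : ∀ x, μ (Set.Iic x) = ENNReal.ofReal (F x)

namespace HasDensityCDF

variable {μ : Measure ℝ} {f F : ℝ → ℝ}

theorem pi_eq (h : HasDensityCDF μ f F) (ι : Type*) [Fintype ι] :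
    Measure.pi (fun _ : ι => μ) =
      (volume : Measure (ι → ℝ)).withDensity fun x => ENNReal.ofReal (∏ i, f (x i)) := by
  rw [h.eq_withDensity]
  exact pi_withDensity_ofReal h.integrable h.nonneg

theorem ae_injective (h : HasDensityCDF μ f F) (ι : Type*) [Fintype ι] :
    ∀ᵐ x ∂Measure.pi (fun _ : ι => μ), Function.Injective x := by
  rw [h.pi_eq]
  exact (withDensity_absolutelyContinuous _ _).ae_le ChaseOS.ae_injective

theorem measure_singleton (h : HasDensityCDF μ f F) (a : ℝ) : μ {a} = 0 := by
  rw [h.eq_withDensity]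
  exact withDensity_absolutelyContinuous _ _ (Real.volume_singleton)

theorem cdf_mono (h : HasDensityCDF μ f F) : Monotone F := fun x y hxy => by
  have := measure_mono (μ := μ) (Set.Iic_subset_Iic.2 hxy)
  rw [h.measure_Iic, h.measure_Iic] at this
  exact (ENNReal.ofReal_le_ofReal_iff (h.cdf_nonneg y)).1 this

theorem cdf_le_one (h : HasDensityCDF μ f F) (x : ℝ) : F x ≤ 1 := by
  have := h.prob
  have := prob_le_one (μ := μ) (s := Set.Iic x)
  rw [h.measure_Iic] at this
  exact ENNReal.ofReal_le_one.1 this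

theorem measure_Iio (h : HasDensityCDF μ f F) (x : ℝ) :
    μ (Set.Iio x) = ENNReal.ofReal (F x) := by
  rw [← h.measure_Iic, ← Set.Iic_sdiff_right, measure_sdiff_null (h.measure_singleton x)]

theorem measure_Ioi (h : HasDensityCDF μ f F) (x : ℝ) :
    μ (Set.Ioi x) = ENNReal.ofReal (1 - F x) := by
  have := h.prob
  rw [← Set.compl_Iic, prob_compl_eq_one_sub measurableSet_Iic, h.measure_Iic,
    ENNReal.ofReal_sub _ (h.cdf_nonneg x), ENNReal.ofReal_one]

theorem measure_Ioo (h : HasDensityCDF μ f F) {x y : ℝ} (hxy : x < y) :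
    μ (Set.Ioo x y) = ENNReal.ofReal (F y - F x) := by
  have := h.prob
  have h1 : Set.Ioo x y = Set.Iio y \ Set.Iic x := by
    ext z; simp
  rw [h1, measure_sdiff (Set.Iic_subset_Iio.2 hxy) nullMeasurableSet_Iic
    (measure_ne_top _ _), h.measure_Iio, h.measure_Iic, ENNReal.ofReal_sub _ (h.cdf_nonneg x)]

theorem osCDF_succ_of_lt (F : ℝ → ℝ) {I : Finset ℕ} (u : I → ℝ) {l : ℕ} (h : l < I.card) :
    osCDF F I u (l + 1) = F (u (I.orderIsoOfFin rfl ⟨l, h⟩)) := by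
  simp [osCDF, h]

theorem osCDF_succ_of_le (F : ℝ → ℝ) {I : Finset ℕ} (u : I → ℝ) {l : ℕ} (h : I.card ≤ l) :
    osCDF F I u (l + 1) = 1 := by
  simp [osCDF, h.not_gt]

theorem osCDF_nonneg (h : HasDensityCDF μ f F) {I : Finset ℕ} (u : I → ℝ) (l : ℕ) :
    0 ≤ osCDF F I u l := by
  unfold osCDF
  split_ifs
  exacts [h.cdf_nonneg _, h.cdf_nonneg _, zero_le_one]

theorem osCDF_le_one (h : HasDensityCDF μ f F) {I : Finset ℕ} (u : I → ℝ) (l : ℕ) :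
    osCDF F I u l ≤ 1 := by
  unfold osCDF
  split_ifs
  exacts [h.cdf_le_one _, h.cdf_le_one _, le_rfl]

theorem osCDF_le_succ (h : HasDensityCDF μ f F) {I : Finset ℕ} {u : I → ℝ} (hu : Monotone u)
    (l : ℕ) : osCDF F I u l ≤ osCDF F I u (l + 1) := by
  rcases l with _ | l
  · have h0 : osCDF F I u 0 = 0 := by simp [osCDF, h.cdf_zero]
    exact h0.trans_le (h.osCDF_nonneg u _)
  · rcases lt_or_ge (l + 1) I.card with h1 | h1
    · rw [osCDF_succ_of_lt F u h1, osCDF_succ_of_lt F u (by omega)]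
      refine h.cdf_mono (hu ((I.orderIsoOfFin rfl).monotone ?_))
      simp
    · rw [osCDF_succ_of_le F u h1]
      exact h.osCDF_le_one u _

/-- The probability of a gap between two consecutive chosen order statistics. -/
theorem measure_gap (h : HasDensityCDF μ f F) {I : Finset ℕ} {u : I → ℝ} (hu : StrictMono u)
    {k : ℕ} (hk : k + 1 ∉ I) :
    μ {r | ∀ i : I, ((i : ℕ) < k + 1 → u i < r) ∧ (k + 1 < (i : ℕ) → r < u i)} =
      ENNReal.ofReal (osCDF F I u (idxCount I k + 1) - osCDF F I u (idxCount I k)) := by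
  have := h.prob
  set ψ := I.orderIsoOfFin rfl with hψ
  have hlt : ∀ j, ((ψ j : I) : ℕ) < k + 1 ↔ (j : ℕ) < idxCount I k := fun j => by
    rw [Nat.lt_succ_iff, lt_idxCount_iff]; rfl
  have hgt : ∀ j, k + 1 < ((ψ j : I) : ℕ) ↔ idxCount I k ≤ (j : ℕ) := fun j => by
    have hne : ((ψ j : I) : ℕ) ≠ k + 1 := fun h => hk (h ▸ (ψ j).2)
    have := hlt j
    omega
  have hset : ∀ r, (∀ i : I, ((i : ℕ) < k + 1 → u i < r) ∧ (k + 1 < (i : ℕ) → r < u i)) ↔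
      ∀ j : Fin I.card, ((j : ℕ) < idxCount I k → u (ψ j) < r) ∧
        (idxCount I k ≤ (j : ℕ) → r < u (ψ j)) := fun r => by
    simp only [← hlt, ← hgt]
    exact ⟨fun h j => h (ψ j), fun h i => by simpa using h (ψ.symm i)⟩
  simp only [hset]
  have hmono : StrictMono (u ∘ ψ) := hu.comp ψ.strictMono
  have hle := idxCount_le_card I k
  generalize idxCount I k = l at hle
  -- The gap `l = 0` lies below all chosen entries, and `F 0 = 0` makes its lower end harmless. The
  -- gap `l = I.card` lies above all of them and has the value `1` at its upper end.
  rcases l with _ | l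
  · have h0 : osCDF F I u 0 = 0 := by simp [osCDF, h.cdf_zero]
    rw [h0, sub_zero]
    rcases Nat.eq_zero_or_pos I.card with h1 | h1
    · rw [osCDF_succ_of_le F u h1.le, ENNReal.ofReal_one, ← measure_univ (μ := μ)]
      congr 1
      ext r
      simp only [Set.mem_ofPred_eq, Set.mem_univ, iff_true]
      intro j
      have := j.2
      omega
    · rw [osCDF_succ_of_lt F u h1, ← h.measure_Iio]
      congr 1
      ext r
      simp only [Set.mem_ofPred_eq, Set.mem_Iio, Nat.not_lt_zero, false_imp_iff, true_and,
        Nat.zero_le, true_imp_iff]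
      exact ⟨fun h => h _, fun h j => h.trans_le (hmono.monotone (Nat.zero_le j))⟩
  · rw [osCDF_succ_of_lt F u hle]
    rcases lt_or_ge (l + 1) I.card with h1 | h1
    · have hll : u (ψ ⟨l, hle⟩) < u (ψ ⟨l + 1, h1⟩) := hmono (by simp)
      rw [osCDF_succ_of_lt F u h1, ← h.measure_Ioo hll]
      congr 1
      ext r
      simp only [Set.mem_ofPred_eq, Set.mem_Ioo]
      exact ⟨fun h => ⟨(h _).1 (Nat.lt_succ_self l), (h ⟨l + 1, h1⟩).2 le_rfl⟩, fun h j =>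
        ⟨fun hj => (hmono.monotone (Nat.lt_succ_iff.1 hj)).trans_lt h.1,
          fun hj => h.2.trans_le (hmono.monotone hj)⟩⟩
    · rw [osCDF_succ_of_le F u h1, ← h.measure_Ioi]
      congr 1
      ext r
      simp only [Set.mem_ofPred_eq, Set.mem_Ioi]
      exact ⟨fun h => (h _).1 (Nat.lt_succ_self l), fun h j =>
        ⟨fun hj => (hmono.monotone (Nat.lt_succ_iff.1 hj)).trans_lt h,
          fun hj => absurd j.2 (by omega)⟩⟩

end HasDensityCDF

/-- The chosen positions and the remaining ones. -/
def idxEquiv {m : ℕ} {I : Finset ℕ} (hI : I ⊆ Icc 1 m) :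
    I ⊕ {k : Fin m // (k : ℕ) + 1 ∉ I} ≃ Fin m :=
  Equiv.ofBijective (Sum.elim (idxPos hI) Subtype.val) <| by
    constructor
    · rintro (i | k) (i' | k') h
      · have h1 := congrArg (fun t : Fin m => (t : ℕ) + 1) h
        simp only [Sum.elim_inl, idxPos_add_one] at h1
        exact congrArg _ (Subtype.ext h1)
      · refine absurd i.2 ?_
        rw [← idxPos_add_one hI i]
        exact (show idxPos hI i = k'.1 from h) ▸ k'.2
      · refine absurd i'.2 ?_
        rw [← idxPos_add_one hI i']
        exact (show k.1 = idxPos hI i' from h) ▸ k.2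
      · exact congrArg _ (Subtype.ext h)
    · intro k
      by_cases hk : (k : ℕ) + 1 ∈ I
      · exact ⟨Sum.inl ⟨_, hk⟩, Fin.ext (by simp [idxPos])⟩
      · exact ⟨Sum.inr ⟨k, hk⟩, rfl⟩

theorem measurePreserving_split {ι κ ν : Type*} [Fintype ι] [Fintype κ] [Fintype ν]
    (μ : Measure ℝ) [SigmaFinite μ] (e : ι ⊕ κ ≃ ν) :
    MeasurePreserving (fun x : ν → ℝ => (fun i => x (e (Sum.inl i)), fun k => x (e (Sum.inr k))))
      (Measure.pi fun _ => μ) ((Measure.pi fun _ => μ).prod (Measure.pi fun _ => μ)) :=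
  (measurePreserving_sumPiEquivProdPi fun _ : ι ⊕ κ => μ).comp (measurePreserving_reindex μ e)

/-- Two unchosen entries of different gaps are separated by a chosen one, so transitivity yields
their comparison. In this form each unchosen entry is constrained by the chosen ones only, as Fubini
requires. -/
theorem mem_gapOrdered_iff {m : ℕ} {I : Finset ℕ} (hI : I ⊆ Icc 1 m) {B : Set (I → ℝ)}
    {x : Fin m → ℝ} :
    x ∈ gapOrdered hI B ↔ (fun i => x (idxPos hI i)) ∈ B ∧
      StrictMono (fun i => x (idxPos hI i)) ∧
      ∀ k : {k : Fin m // (k : ℕ) + 1 ∉ I}, ∀ i : I,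
        ((i : ℕ) < (k : Fin m) + 1 → x (idxPos hI i) < x k) ∧
        ((k : Fin m) + 1 < (i : ℕ) → x k < x (idxPos hI i)) := by
  have hpos : ∀ i : I, (idxPos hI i : ℕ) + 1 ∈ I := fun i => by rw [idxPos_add_one]; exact i.2
  refine and_congr_right fun _ => ?_
  constructor
  · intro h
    refine ⟨fun i j hij => ?_, fun k i => ⟨fun hik => ?_, fun hki => ?_⟩⟩
    · refine h _ _ (gapColor_lt_iff.2 ⟨?_, Or.inl (hpos i)⟩)
      have h1 : (i : ℕ) < j := hij
      have := idxPos_add_one hI i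
      have := idxPos_add_one hI j
      exact Fin.lt_def.2 (by omega)
    · refine h _ _ (gapColor_lt_iff.2 ⟨?_, Or.inl (hpos i)⟩)
      have := idxPos_add_one hI i
      exact Fin.lt_def.2 (by omega)
    · refine h _ _ (gapColor_lt_iff.2 ⟨?_, Or.inr (Or.inl (hpos i))⟩)
      have := idxPos_add_one hI i
      exact Fin.lt_def.2 (by omega)
  · rintro ⟨hmono, hgap⟩ j k hjk
    obtain ⟨hlt, hjk⟩ := gapColor_lt_iff.1 hjk
    have hlt' : (j : ℕ) < k := hlt
    have hval : ∀ (k : Fin m) (hk : (k : ℕ) + 1 ∈ I), idxPos hI ⟨_, hk⟩ = k := fun k hk =>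
      Fin.ext (by simp [idxPos])
    by_cases hj : (j : ℕ) + 1 ∈ I
    · by_cases hk : (k : ℕ) + 1 ∈ I
      · have := @hmono ⟨_, hj⟩ ⟨_, hk⟩ (by simpa using hlt')
        simpa only [hval] using this
      · have := (hgap ⟨k, hk⟩ ⟨_, hj⟩).1 (by simpa using hlt')
        simpa only [hval] using this
    · by_cases hk : (k : ℕ) + 1 ∈ I
      · have := (hgap ⟨j, hj⟩ ⟨_, hk⟩).2 (by simpa using hlt')
        simpa only [hval] using this
      · obtain ⟨i, hi, h1, h2⟩ := (hjk.resolve_left hj).resolve_left hk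
        exact ((hgap ⟨j, hj⟩ ⟨i, hi⟩).2 h1).trans ((hgap ⟨k, hk⟩ ⟨i, hi⟩).1 h2)

namespace HasDensityCDF

variable {μ : Measure ℝ} {f F : ℝ → ℝ}

/-- All positions of a gap contribute the same factor, and `card_gap` counts them; this produces the
exponents of the joint density. -/
theorem prod_measure_gap (h : HasDensityCDF μ f F) {m : ℕ} {I : Finset ℕ} (hI : I ⊆ Icc 1 m)
    {u : I → ℝ} (hu : StrictMono u) :
    ∏ k : {k : Fin m // (k : ℕ) + 1 ∉ I},
      μ {r | ∀ i : I, ((i : ℕ) < (k : Fin m) + 1 → u i < r) ∧ ((k : Fin m) + 1 < (i : ℕ) → r < u i)}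
      = ENNReal.ofReal (∏ l ∈ range (I.card + 1),
        (osCDF F I u (l + 1) - osCDF F I u l) ^ (osIndex m I (l + 1) - osIndex m I l - 1)) := by
  set D : ℕ → ℝ := fun l => osCDF F I u (l + 1) - osCDF F I u l
  have hD : ∀ l, 0 ≤ D l := fun l => sub_nonneg.2 (h.osCDF_le_succ hu.monotone l)
  have h1 : ∀ k : {k : Fin m // (k : ℕ) + 1 ∉ I},
      μ {r | ∀ i : I, ((i : ℕ) < (k : Fin m) + 1 → u i < r) ∧
        ((k : Fin m) + 1 < (i : ℕ) → r < u i)} =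
      ENNReal.ofReal (D (idxCount I (k : Fin m))) := fun k => h.measure_gap hu k.2
  rw [prod_congr rfl fun k _ => h1 k, ← ENNReal.ofReal_prod_of_nonneg fun k _ => hD _]
  congr 1
  have h2 : ∏ k : {k : Fin m // (k : ℕ) + 1 ∉ I}, D (idxCount I (k : Fin m)) =
      ∏ k ∈ univ.filter (fun k : Fin m => (k : ℕ) + 1 ∉ I), D (idxCount I k) :=
    (prod_subtype _ (fun k => by simp) fun k : Fin m => D (idxCount I k)).symm
  rw [h2, ← prod_fiberwise_of_maps_to (t := range (I.card + 1)) (g := fun k : Fin m => idxCount I k)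
    fun k _ => mem_range.2 (Nat.lt_succ_of_le (idxCount_le_card I k))]
  refine prod_congr rfl fun l hl => ?_
  rw [filter_filter, ← card_gap hI (Nat.lt_succ_iff.1 (mem_range.1 hl))]
  exact prod_eq_pow_card fun k hk => by rw [(mem_filter.1 hk).2.2]

-- Fubini over the chosen and the unchosen coordinates: for a fixed strictly increasing `u` in `B`,
-- the section is a product of one set per unchosen position.
open Classical in
theorem pi_measure_gapOrdered_eq (h : HasDensityCDF μ f F) {m : ℕ} {I : Finset ℕ}
    (hI : I ⊆ Icc 1 m) {B : Set (I → ℝ)} (hB : MeasurableSet B) :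
    (Measure.pi fun _ : Fin m => μ) (gapOrdered hI B) =
      ∫⁻ u, (B ∩ {u | StrictMono u}).indicator (fun u => ENNReal.ofReal
        (∏ l ∈ range (I.card + 1), (osCDF F I u (l + 1) - osCDF F I u l) ^
          (osIndex m I (l + 1) - osIndex m I l - 1))) u ∂(Measure.pi fun _ : I => μ) := by
  have := h.prob
  set G : Set ((I → ℝ) × ({k : Fin m // (k : ℕ) + 1 ∉ I} → ℝ)) :=
    {p | p.1 ∈ B ∧ StrictMono p.1 ∧ ∀ k : {k : Fin m // (k : ℕ) + 1 ∉ I}, ∀ i : I,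
      ((i : ℕ) < (k : Fin m) + 1 → p.1 i < p.2 k) ∧ ((k : Fin m) + 1 < (i : ℕ) → p.2 k < p.1 i)}
  have hG : MeasurableSet G := by
    refine (measurable_fst hB).inter ((measurable_fst measurableSet_setOf_strictMono).inter ?_)
    refine MeasurableSet.congr (s := ⋂ k : {k : Fin m // (k : ℕ) + 1 ∉ I}, ⋂ i : I,
      {p : (I → ℝ) × ({k : Fin m // (k : ℕ) + 1 ∉ I} → ℝ) |
        ((i : ℕ) < (k : Fin m) + 1 → p.1 i < p.2 k) ∧ ((k : Fin m) + 1 < (i : ℕ) → p.2 k < p.1 i)})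
      (MeasurableSet.iInter fun k => MeasurableSet.iInter fun i => ?_)
      (by ext p; simp only [Set.mem_iInter]; rfl)
    have h1 : Measurable fun p : (I → ℝ) × ({k : Fin m // (k : ℕ) + 1 ∉ I} → ℝ) => p.1 i :=
      (measurable_pi_apply i).comp measurable_fst
    have h2 : Measurable fun p : (I → ℝ) × ({k : Fin m // (k : ℕ) + 1 ∉ I} → ℝ) => p.2 k :=
      (measurable_pi_apply k).comp measurable_snd
    exact ((MeasurableSet.const _).imp (measurableSet_lt h1 h2)).inter
      ((MeasurableSet.const _).imp (measurableSet_lt h2 h1))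
  have hpre : gapOrdered hI B = (fun x : Fin m → ℝ => (fun i => x (idxEquiv hI (Sum.inl i)),
      fun k => x (idxEquiv hI (Sum.inr k)))) ⁻¹' G := by
    ext x
    exact mem_gapOrdered_iff hI
  rw [hpre, (measurePreserving_split μ (idxEquiv hI)).measure_preimage hG.nullMeasurableSet,
    Measure.prod_apply hG]
  refine lintegral_congr fun u => ?_
  by_cases hu : u ∈ B ∩ {u | StrictMono u}
  · rw [Set.indicator_of_mem hu, ← h.prod_measure_gap hI hu.2, ← Measure.pi_pi]
    congr 1
    ext v
    simp only [Set.mem_preimage, Set.mem_univ_pi]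
    exact ⟨fun hv => hv.2.2, fun hv => ⟨hu.1, hu.2, hv⟩⟩
  · rw [Set.indicator_of_notMem hu]
    convert measure_empty (μ := Measure.pi fun _ : {k : Fin m // (k : ℕ) + 1 ∉ I} => μ)
    ext v
    simp only [Set.mem_preimage, Set.mem_empty_iff_false, iff_false]
    exact fun hv => hu ⟨hv.1, hv.2.1⟩

theorem measurable_cdf (h : HasDensityCDF μ f F) : Measurable F := h.cdf_mono.measurable

theorem measurable_osCDF (h : HasDensityCDF μ f F) (I : Finset ℕ) (l : ℕ) :
    Measurable fun u : I → ℝ => osCDF F I u l := by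
  unfold osCDF
  split_ifs
  exacts [measurable_const, h.measurable_cdf.comp (measurable_pi_apply _), measurable_const]

theorem measurable_jointOSDensity (h : HasDensityCDF μ f F) (m : ℕ) (I : Finset ℕ) :
    Measurable (jointOSDensity f F m I) := by
  classical
  unfold jointOSDensity
  refine Measurable.ite ?_ ?_ measurable_const
  · have : {x : I → ℝ | Monotone x} = ⋂ i, ⋂ j, {x | i ≤ j → x i ≤ x j} := by
      ext x; simp [Monotone]
    rw [this]
    exact MeasurableSet.iInter fun i => MeasurableSet.iInter fun j =>
      (MeasurableSet.const _).imp
        (measurableSet_le (measurable_pi_apply i) (measurable_pi_apply j))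
  · refine (measurable_const.mul (Finset.measurable_prod _ fun i _ =>
      h.measurable.comp (measurable_pi_apply i))).mul (Finset.measurable_prod _ fun l _ => ?_)
    exact (((h.measurable_osCDF I _).sub (h.measurable_osCDF I _)).pow_const _).div_const _

theorem jointOSDensity_nonneg (h : HasDensityCDF μ f F) (m : ℕ) (I : Finset ℕ) (u : I → ℝ) :
    0 ≤ jointOSDensity f F m I u := by
  unfold jointOSDensity
  split_ifs with hu
  · have h1 : 0 ≤ ∏ i, f (u i) := prod_nonneg fun i _ => h.nonneg _
    have h2 : ∀ l, 0 ≤ osCDF F I u (l + 1) - osCDF F I u l := fun l =>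
      sub_nonneg.2 (h.osCDF_le_succ hu l)
    refine mul_nonneg (by positivity) (prod_nonneg fun l _ => ?_)
    exact div_nonneg (pow_nonneg (h2 l) _) (Nat.cast_nonneg _)
  · exact le_rfl

/-- The chosen order statistics of an independent sample have the joint density
`jointOSDensity`. -/
theorem map_orderStat (h : HasDensityCDF μ f F) {m : ℕ} {I : Finset ℕ} (hI : I ⊆ Icc 1 m) :
    (Measure.pi fun _ : Fin m => μ).map (fun x i => orderStat x (idxPos hI i)) =
      (volume : Measure (I → ℝ)).withDensity
        fun u => ENNReal.ofReal (jointOSDensity f F m I u) := by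
  classical
  have := h.prob
  refine Measure.ext fun B hB => ?_
  rw [Measure.map_apply (measurable_pi_lambda _ fun i => measurable_orderStat _) hB,
    withDensity_apply _ hB]
  have hproj : Measurable fun (x : Fin m → ℝ) i => x (idxPos hI i) :=
    measurable_pi_lambda _ fun i => measurable_pi_apply _
  have h1 := pi_measure_sorted_mem μ (h.ae_injective (Fin m)) (hproj hB)
  have h2 := pi_measure_gapOrdered hI μ (h.ae_injective (Fin m)) hB
  have h3 := h.pi_measure_gapOrdered_eq hI hB
  set K : ℕ := (gapPerms m I).card
  have hK : K ≠ 0 := by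
    refine (card_pos.2 ⟨1, ?_⟩).ne'
    simp [gapPerms]
  have hKR : (K : ENNReal) ≠ 0 := by exact_mod_cast hK
  -- Increasing samples are eliminated between `h1` and `h2`: `K` times the wanted measure is `m !`
  -- times the measure of `gapOrdered`. The factor `K` then cancels the factorials in the
  -- denominators of the density.
  refine (ENNReal.mul_right_inj hKR (ENNReal.natCast_ne_top K)).1 ?_
  calc (K : ENNReal) * (Measure.pi fun _ : Fin m => μ) 
          ((fun x i => orderStat x (idxPos hI i)) ⁻¹' B)
      = (m ! : ENNReal) * (Measure.pi fun _ : Fin m => μ) (gapOrdered hI B) := by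
        rw [h2, mul_left_comm]
        exact congrArg _ h1
    _ = ∫⁻ u, (m ! : ENNReal) * (ENNReal.ofReal (∏ i, f (u i)) *
          (B ∩ {u | StrictMono u}).indicator (fun u => ENNReal.ofReal
          (∏ l ∈ range (I.card + 1), (osCDF F I u (l + 1) - osCDF F I u l) ^
          (osIndex m I (l + 1) - osIndex m I l - 1))) u) := by
        have hm1 : Measurable fun u : I → ℝ => ENNReal.ofReal (∏ i, f (u i)) :=
          (Finset.measurable_prod _ fun i _ =>
            h.measurable.comp (measurable_pi_apply i)).ennreal_ofReal
        have hm2 : Measurable ((B ∩ {u | StrictMono u}).indicator fun u : I → ℝ => ENNReal.ofReal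
          (∏ l ∈ range (I.card + 1), (osCDF F I u (l + 1) - osCDF F I u l) ^
          (osIndex m I (l + 1) - osIndex m I l - 1))) := by
          refine Measurable.indicator (Measurable.ennreal_ofReal ?_)
            (hB.inter measurableSet_setOf_strictMono)
          exact Finset.measurable_prod _ fun l _ =>
            ((h.measurable_osCDF I _).sub (h.measurable_osCDF I _)).pow_const _
        rw [h3, h.pi_eq, lintegral_withDensity_eq_lintegral_mul _ hm1 hm2]
        exact (lintegral_const_mul _ (hm1.mul hm2)).symm
    _ = ∫⁻ u, (K : ENNReal) * B.indicator
          (fun u => ENNReal.ofReal (jointOSDensity f F m I u)) u := by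
        refine lintegral_congr_ae ?_
        -- The density is supported on weakly increasing vectors, the Fubini integral on strictly
        -- increasing ones; the difference is a null set.
        filter_upwards [ChaseOS.ae_injective] with u hu
        by_cases huB : u ∈ B
        · by_cases hmono : Monotone u
          · have huS : u ∈ B ∩ {u | StrictMono u} := ⟨huB, hmono.strictMono_of_injective hu⟩
            rw [Set.indicator_of_mem huS,
              Set.indicator_of_mem huB, ← ENNReal.ofReal_natCast, ← ENNReal.ofReal_natCast,
              ← ENNReal.ofReal_mul (prod_nonneg fun i _ => h.nonneg _),
              ← ENNReal.ofReal_mul (Nat.cast_nonneg _), ← ENNReal.ofReal_mul (Nat.cast_nonneg _)]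
            congr 1
            rw [jointOSDensity, if_pos hmono, prod_div_distrib]
            have hKe : (K : ℝ) = ∏ l ∈ range (I.card + 1),
                ((osIndex m I (l + 1) - osIndex m I l - 1)! : ℝ) := by
              rw [← Nat.cast_prod, ← card_gapPerms hI]
            rw [← hKe]
            have : (K : ℝ) ≠ 0 := by exact_mod_cast hK
            field_simp
          · rw [Set.indicator_of_notMem fun hm => hmono hm.2.monotone, Set.indicator_of_mem huB,
              jointOSDensity, if_neg hmono]
            simp
        · rw [Set.indicator_of_notMem fun hm => huB hm.1, Set.indicator_of_notMem huB]
          simp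
    _ = K * ∫⁻ u in B, ENNReal.ofReal (jointOSDensity f F m I u) := by
        rw [lintegral_const_mul _
          ((h.measurable_jointOSDensity m I).ennreal_ofReal.indicator hB), lintegral_indicator hB]

end HasDensityCDF

/-! ### The reliability of a Gaussian observation given its sign -/

theorem toNNReal_sq_ne_zero {σ : ℝ} (hσ : 0 < σ) : Real.toNNReal (σ ^ 2) ≠ 0 :=
  (Real.toNNReal_pos.2 (by positivity)).ne'

theorem qσ_sub_eq (σ a x : ℝ) :
    qσ σ (x - a) = gaussianPDFReal a (Real.toNNReal (σ ^ 2)) x := by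
  rw [qσ, gaussianPDFReal, Real.coe_toNNReal _ (sq_nonneg σ), one_div]

theorem tailQ_eq {σ : ℝ} (hσ : 0 < σ) (x : ℝ) :
    ENNReal.ofReal (tailQ σ x) = gaussianReal 0 (Real.toNNReal (σ ^ 2)) (Set.Ioi x) := by
  rw [gaussianReal_apply_eq_integral _ (toNNReal_sq_ne_zero hσ), tailQ]
  congr 1
  refine integral_congr_ae (Filter.Eventually.of_forall fun s => ?_)
  simpa using qσ_sub_eq σ 0 s

theorem tailQ_nonneg (σ x : ℝ) : 0 ≤ tailQ σ x :=
  integral_nonneg fun s => by rw [← sub_zero s, qσ_sub_eq]; exact gaussianPDFReal_nonneg _ _ _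

theorem gaussianReal_Ioi {σ : ℝ} (hσ : 0 < σ) (a x : ℝ) :
    gaussianReal a (Real.toNNReal (σ ^ 2)) (Set.Ioi x) = ENNReal.ofReal (tailQ σ (x - a)) := by
  have h := gaussianReal_map_add_const (μ := 0) (v := Real.toNNReal (σ ^ 2)) a
  rw [zero_add] at h
  rw [← h, Measure.map_apply (measurable_add_const a) measurableSet_Ioi, tailQ_eq hσ]
  congr 1
  ext z
  simp [sub_lt_iff_lt_add]

theorem tailQ_pos {σ : ℝ} (hσ : 0 < σ) (x : ℝ) : 0 < tailQ σ x := by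
  have h : 0 < gaussianReal 0 (Real.toNNReal (σ ^ 2)) (Set.Ioi x) := by
    refine pos_iff_ne_zero.2 fun h => ?_
    have := gaussianReal_absolutelyContinuous' 0 (toNNReal_sq_ne_zero hσ) h
    simp at this
  rw [← tailQ_eq hσ] at h
  exact ENNReal.ofReal_pos.1 h

/-- By the symmetry of the centred Gaussian. The normalisation `1 - tailQ σ 1` of `fc` thus becomes
`tailQ σ (-1)`, and both densities are truncated Gaussians, with means `1` and `-1`. -/
theorem tailQ_neg {σ : ℝ} (hσ : 0 < σ) (x : ℝ) : tailQ σ (-x) = 1 - tailQ σ x := by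
  have := nullSingletonClass_gaussianReal (μ := 0) (toNNReal_sq_ne_zero hσ)
  have h1 : gaussianReal 0 (Real.toNNReal (σ ^ 2)) (Set.Ioi (-x)) =
      1 - gaussianReal 0 (Real.toNNReal (σ ^ 2)) (Set.Ioi x) := by
    have h := gaussianReal_map_neg (μ := 0) (v := Real.toNNReal (σ ^ 2))
    rw [neg_zero] at h
    rw [← prob_compl_eq_one_sub measurableSet_Ioi, Set.compl_Ioi, ← measure_congr Iio_ae_eq_Iic]
    conv_lhs => rw [← h]
    rw [Measure.map_apply measurable_neg measurableSet_Ioi]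
    congr 1
    ext z
    simp
  rw [← tailQ_eq hσ, ← tailQ_eq hσ, ← ENNReal.ofReal_one,
    ← ENNReal.ofReal_sub _ (tailQ_nonneg σ x)] at h1
  have h2 : ENNReal.ofReal (tailQ σ x) ≤ 1 := tailQ_eq hσ x ▸ prob_le_one
  exact (ENNReal.ofReal_eq_ofReal_iff (tailQ_nonneg _ _)
    (sub_nonneg.2 (ENNReal.ofReal_le_one.1 h2))).1 h1

/-- The density of a Gaussian variable with mean `a`, conditioned to be non-negative. -/
def truncDensity (σ a x : ℝ) : ℝ := if 0 ≤ x then qσ σ (x - a) / tailQ σ (-a) else 0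

/-- The distribution function of a Gaussian variable with mean `a`, conditioned to be
non-negative. -/
def truncCDF (σ a x : ℝ) : ℝ :=
  if 0 ≤ x then (tailQ σ (-a) - tailQ σ (x - a)) / tailQ σ (-a) else 0

theorem fe_eq (σ : ℝ) : fe σ = truncDensity σ (-1) := by
  funext x; simp [fe, truncDensity]

theorem Fe_eq (σ : ℝ) : Fe σ = truncCDF σ (-1) := by
  funext x; simp [Fe, truncCDF]

theorem fc_eq {σ : ℝ} (hσ : 0 < σ) : fc σ = truncDensity σ 1 := by
  funext x; simp [fc, truncDensity, tailQ_neg hσ]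

theorem Fc_eq {σ : ℝ} (hσ : 0 < σ) : Fc σ = truncCDF σ 1 := by
  funext x; simp [Fc, truncCDF, tailQ_neg hσ]

/-- The law with density `truncDensity`. -/
def truncLaw (σ a : ℝ) : Measure ℝ :=
  volume.withDensity fun x => ENNReal.ofReal (truncDensity σ a x)

theorem truncDensity_eq (σ a : ℝ) : truncDensity σ a = (Set.Ici 0).indicator
    fun x => gaussianPDFReal a (Real.toNNReal (σ ^ 2)) x / tailQ σ (-a) := by
  funext x
  simp [truncDensity, Set.indicator_apply, qσ_sub_eq]

theorem measurable_truncDensity (σ a : ℝ) : Measurable (truncDensity σ a) := by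
  rw [truncDensity_eq]
  exact ((measurable_gaussianPDFReal _ _).div_const _).indicator measurableSet_Ici

theorem smul_truncLaw {σ : ℝ} (hσ : 0 < σ) (a : ℝ) :
    ENNReal.ofReal (tailQ σ (-a)) • truncLaw σ a =
      (gaussianReal a (Real.toNNReal (σ ^ 2))).restrict (Set.Ici 0) := by
  rw [gaussianReal_of_var_ne_zero _ (toNNReal_sq_ne_zero hσ),
    restrict_withDensity measurableSet_Ici, ← withDensity_indicator measurableSet_Ici, truncLaw,
    ← withDensity_smul _ (measurable_truncDensity σ a).ennreal_ofReal]
  congr 1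
  funext x
  have hr := tailQ_pos hσ (-a)
  simp only [Pi.smul_apply, smul_eq_mul, truncDensity_eq, Set.indicator_apply]
  split_ifs
  · rw [← ENNReal.ofReal_mul hr.le, gaussianPDF, mul_div_cancel₀ _ hr.ne']
  · simp

theorem hasDensityCDF_truncLaw {σ : ℝ} (hσ : 0 < σ) (a : ℝ) :
    HasDensityCDF (truncLaw σ a) (truncDensity σ a) (truncCDF σ a) := by
  have := nullSingletonClass_gaussianReal (μ := a) (toNNReal_sq_ne_zero hσ)
  have hr := tailQ_pos hσ (-a)
  -- Total mass and distribution function are computed after multiplication by `tailQ σ (-a)`, which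
  -- is positive and finite and turns the law into the Gaussian one on `[0, ∞)`.
  have happ : ∀ s, MeasurableSet s → ENNReal.ofReal (tailQ σ (-a)) * truncLaw σ a s =
      gaussianReal a (Real.toNNReal (σ ^ 2)) (s ∩ Set.Ici 0) := fun s hs => by
    rw [← Measure.restrict_apply hs, ← smul_truncLaw hσ, Measure.smul_apply, smul_eq_mul]
  have hr0 : ENNReal.ofReal (tailQ σ (-a)) ≠ 0 := (ENNReal.ofReal_pos.2 hr).ne'
  have htail : ∀ x, 0 ≤ x → tailQ σ (x - a) ≤ tailQ σ (-a) := fun x hx => by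
    rw [← ENNReal.ofReal_le_ofReal_iff hr.le, tailQ_eq hσ, tailQ_eq hσ]
    exact measure_mono (Set.Ioi_subset_Ioi (by linarith))
  refine ⟨⟨?_⟩, measurable_truncDensity σ a, fun x => ?_, ?_, rfl, fun x => ?_, ?_, fun x => ?_⟩
  · refine (ENNReal.mul_right_inj hr0 ENNReal.ofReal_ne_top).1 ?_
    rw [happ _ MeasurableSet.univ, Set.univ_inter, ← measure_congr Ioi_ae_eq_Ici,
      gaussianReal_Ioi hσ, zero_sub, mul_one]
  · rw [truncDensity_eq]
    exact Set.indicator_nonneg (fun x _ => div_nonneg (gaussianPDFReal_nonneg _ _ _) hr.le) x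
  · rw [truncDensity_eq]
    exact ((integrable_gaussianPDFReal _ _).div_const _).indicator measurableSet_Ici
  · unfold truncCDF
    split_ifs with hx
    · exact div_nonneg (sub_nonneg.2 (htail x hx)) hr.le
    · exact le_rfl
  · simp [truncCDF]
  · refine (ENNReal.mul_right_inj hr0 ENNReal.ofReal_ne_top).1 ?_
    rw [happ _ measurableSet_Iic, ← ENNReal.ofReal_mul hr.le]
    unfold truncCDF
    split_ifs with hx
    · rw [mul_div_cancel₀ _ hr.ne', ENNReal.ofReal_sub _ (tailQ_nonneg _ _), ← zero_sub a,
        ← gaussianReal_Ioi hσ, ← gaussianReal_Ioi hσ, ← measure_sdiff (Set.Ioi_subset_Ioi hx)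
        nullMeasurableSet_Ioi (measure_ne_top _ _), Set.Iic_inter_Ici,
        ← measure_congr Ioc_ae_eq_Icc]
      congr 1
      ext z; simp
    · rw [Set.Iic_inter_Ici, Set.Icc_eq_empty hx]
      simp

theorem map_abs_restrict_Ici {σ : ℝ} (hσ : 0 < σ) :
    ((gaussianReal 1 (Real.toNNReal (σ ^ 2))).restrict (Set.Ici 0)).map (fun x => |x|) =
      ENNReal.ofReal (1 - tailQ σ 1) • truncLaw σ 1 := by
  rw [← tailQ_neg hσ, smul_truncLaw hσ]
  have : (fun x : ℝ => |x|) =ᵐ[(gaussianReal 1 (Real.toNNReal (σ ^ 2))).restrict (Set.Ici 0)] id := by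
    filter_upwards [ae_restrict_mem measurableSet_Ici] with x hx
    exact abs_of_nonneg hx
  rw [Measure.map_congr this, Measure.map_id]

/-- On the negative half-line the absolute value is the reflection, which takes `N(1, σ²)` to `N(-1,
σ²)`; hence the mean `-1` for wrong decisions. -/
theorem map_abs_restrict_Iio {σ : ℝ} (hσ : 0 < σ) :
    ((gaussianReal 1 (Real.toNNReal (σ ^ 2))).restrict (Set.Iio 0)).map (fun x => |x|) =
      ENNReal.ofReal (tailQ σ 1) • truncLaw σ (-1) := by
  have := nullSingletonClass_gaussianReal (μ := -1) (toNNReal_sq_ne_zero hσ)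
  have h1 := smul_truncLaw hσ (-1)
  rw [neg_neg] at h1
  rw [h1, ← Measure.restrict_congr_set Ioi_ae_eq_Ici, ← gaussianReal_map_neg,
    Measure.restrict_map measurable_neg measurableSet_Ioi]
  have hset : (fun x : ℝ => -x) ⁻¹' Set.Ioi 0 = Set.Iio 0 := by ext z; simp
  rw [hset]
  refine Measure.map_congr ?_
  filter_upwards [ae_restrict_mem measurableSet_Iio] with x hx
  exact abs_of_neg hx

/-! ### Merging two sorted lists -/

/-- The `i`-th entry (`i ≥ 1`) of a list, `⊤` out of range. -/
def extTop {b : ℕ} (β : Fin b → ℝ) (i : ℕ) : EReal :=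
  if h : 1 ≤ i ∧ i ≤ b then (β ⟨i - 1, by omega⟩ : EReal) else ⊤

theorem extTop_succ {b : ℕ} (β : Fin b → ℝ) (a : Fin b) : extTop β (a + 1) = β a := by
  have := a.2
  rw [extTop, dif_pos (by omega)]
  rfl

theorem exists_of_extTop_lt_top {b : ℕ} {β : Fin b → ℝ} {i : ℕ} (h : extTop β i < ⊤) :
    ∃ a : Fin b, (a : ℕ) + 1 = i := by
  unfold extTop at h
  split_ifs at h with h'
  · exact ⟨⟨i - 1, by omega⟩, by simp only; omega⟩
  · exact absurd h (lt_irrefl _)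

theorem extTop_le_extTop {b : ℕ} {β : Fin b → ℝ} (hβ : Monotone β) {i j : ℕ} (hi : 1 ≤ i)
    (hij : i ≤ j) : extTop β i ≤ extTop β j := by
  unfold extTop
  split_ifs with h1 h2
  · exact EReal.coe_le_coe_iff.2 (hβ (Fin.mk_le_mk.2 (by omega)))
  · exact le_top
  · omega
  · exact le_rfl

/-- The number of entries that are at most `x`. -/
def countLE {b : ℕ} (β : Fin b → ℝ) (x : ℝ) : ℕ := (univ.filter fun a => β a ≤ x).card

/-- Translates order conditions into counts. The value `⊤` out of range is the right one: both sides
then fail for `i > b`. -/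
theorem extTop_le_coe_iff {b : ℕ} {β : Fin b → ℝ} (hβ : Monotone β) {i : ℕ} (hi : 1 ≤ i) {x : ℝ} :
    extTop β i ≤ (x : EReal) ↔ i ≤ countLE β x := by
  by_cases h : i ≤ b
  · rw [extTop, dif_pos ⟨hi, h⟩, EReal.coe_le_coe_iff,
      ← Tuple.lt_card_le_iff_apply_le_of_monotone hβ]
    simp only [countLE]
    omega
  · rw [extTop, dif_neg (by omega)]
    have : countLE β x ≤ b := (card_le_univ _).trans_eq (Fintype.card_fin b)
    simp only [top_le_iff, EReal.coe_ne_top, false_iff]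
    omega

theorem countLE_self {b : ℕ} {β : Fin b → ℝ} (hβ : StrictMono β) (a : Fin b) :
    countLE β (β a) = a + 1 := by
  simp only [countLE, hβ.le_iff_le]
  rw [show univ.filter (fun x => x ≤ a) = Iic a by ext; simp, Fin.card_Iic]

/-- The sorted list `s` is the result of merging the sorted lists `β` and `γ`; `q k` says that the
`k`-th entry of `s` (counting from `0`) stems from `β`. -/
structure IsMerge {n b m : ℕ} (s : Fin n → ℝ) (β : Fin b → ℝ) (γ : Fin m → ℝ)
    (τ : Fin b ⊕ Fin m ≃ Fin n) (q : ℕ → Prop) : Prop where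
  strictMono : StrictMono s
  left_strictMono : StrictMono β
  right_strictMono : StrictMono γ
  left : ∀ a, s (τ (Sum.inl a)) = β a
  right : ∀ c, s (τ (Sum.inr c)) = γ c
  left_iff : ∀ a, q (τ (Sum.inl a))
  right_iff : ∀ c, ¬ q (τ (Sum.inr c))

namespace IsMerge

variable {n b m : ℕ} {s : Fin n → ℝ} {β : Fin b → ℝ} {γ : Fin m → ℝ}
  {τ : Fin b ⊕ Fin m ≃ Fin n} {q : ℕ → Prop} [DecidablePred q]

omit [DecidablePred q] in
theorem symm (h : IsMerge s β γ τ q) :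
    IsMerge s γ β ((Equiv.sumComm _ _).trans τ) fun k => ¬ q k :=
  ⟨h.strictMono, h.right_strictMono, h.left_strictMono, h.right, h.left, h.right_iff,
    fun c hc => hc (h.left_iff c)⟩

omit [DecidablePred q] in
theorem exists_left (h : IsMerge s β γ τ q) {k : Fin n} (hk : q k) : ∃ a, τ (Sum.inl a) = k := by
  obtain ⟨a | c, rfl⟩ := τ.surjective k
  · exact ⟨a, rfl⟩
  · exact absurd hk (h.right_iff c)

theorem countLE_left (h : IsMerge s β γ τ q) (k : Fin n) :
    countLE β (s k) = Nat.count q (k + 1) := by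
  rw [Nat.count_eq_card_filter_range, countLE]
  refine card_bij (fun a _ => (τ (Sum.inl a) : ℕ)) ?_ ?_ ?_
  · intro a ha
    rw [mem_filter, ← h.left, h.strictMono.le_iff_le] at ha
    have : (τ (Sum.inl a) : ℕ) ≤ k := ha.2
    simp only [mem_filter, mem_range]
    exact ⟨by omega, h.left_iff a⟩
  · intro a _ a' _ haa
    simpa using τ.injective (Fin.ext haa)
  · intro l hl
    simp only [mem_filter, mem_range] at hl
    obtain ⟨a, ha⟩ := h.exists_left (k := ⟨l, by omega⟩) hl.2
    refine ⟨a, ?_, by rw [ha]⟩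
    simp only [mem_filter, mem_univ, true_and]
    rw [← h.left, ha, h.strictMono.le_iff_le]
    exact Fin.mk_le_of_le_val (by omega)

omit [DecidablePred q] in
theorem countLE_add (h : IsMerge s β γ τ q) (x : ℝ) :
    countLE s x = countLE β x + countLE γ x := by
  simp only [countLE, card_filter]
  rw [← Equiv.sum_comp τ, Fintype.sum_sum_type]
  simp only [h.left, h.right]

/-- The entry `s k` in terms of `β`, if it stems from `β`. -/
theorem extTop_count (h : IsMerge s β γ τ q) {k : Fin n} (hk : q k) :
    extTop β (Nat.count q (k + 1)) = s k := by
  obtain ⟨a, rfl⟩ := h.exists_left hk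
  rw [← h.countLE_left, h.left, countLE_self h.left_strictMono, extTop_succ]

end IsMerge

theorem count_add_count_not (p : ℕ → Prop) [DecidablePred p] (k : ℕ) :
    Nat.count p k + Nat.count (fun i => ¬ p i) k = k := by
  induction k with
  | zero => simp
  | succ k ih =>
    rw [Nat.count_succ, Nat.count_succ]
    split_ifs <;> omega

/-- The symbol at position `k` (counting from `0`), if the merge follows the pattern `p`. -/
def patternValue {b m : ℕ} (β : Fin b → ℝ) (γ : Fin m → ℝ) (p : ℕ → Prop) [DecidablePred p]
    (k : ℕ) : EReal :=
  if p k then extTop β (Nat.count p (k + 1)) else extTop γ (Nat.count (fun i => ¬ p i) (k + 1))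

section

variable {n b m : ℕ} {s : Fin n → ℝ} {β : Fin b → ℝ} {γ : Fin m → ℝ}
  {τ : Fin b ⊕ Fin m ≃ Fin n} {q : ℕ → Prop} [DecidablePred q]

theorem IsMerge.conditions_of_agree (h : IsMerge s β γ τ q) {p : ℕ → Prop} [DecidablePred p]
    {M : ℕ} (hMn : M < n) (hagree : ∀ k ≤ M, (q k ↔ p k)) :
    (∀ k < M, patternValue β γ p k ≤ patternValue β γ p (k + 1)) ∧
      patternValue β γ p M ≤ extTop γ (Nat.count (fun i => ¬ p i) (M + 1) + 1) := by
  have hc1 : ∀ k ≤ M, Nat.count p (k + 1) = Nat.count q (k + 1) := fun k hk => by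
    simp only [Nat.count_eq_card_filter_range]
    congr 1
    exact filter_congr fun i hi => (hagree i (by rw [mem_range] at hi; omega)).symm
  have hc2 : ∀ k ≤ M, Nat.count (fun i => ¬ p i) (k + 1) = Nat.count (fun i => ¬ q i) (k + 1) :=
    fun k hk => by
    simp only [Nat.count_eq_card_filter_range]
    congr 1
    exact filter_congr fun i hi => not_congr (hagree i (by rw [mem_range] at hi; omega)).symm
  have hV : ∀ k (hk : k ≤ M), patternValue β γ p k = s ⟨k, by omega⟩ := fun k hk => by
    unfold patternValue
    split_ifs with hp
    · rw [hc1 k hk]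
      exact h.extTop_count (k := ⟨k, by omega⟩) ((hagree k hk).2 hp)
    · rw [hc2 k hk]
      exact h.symm.extTop_count (k := ⟨k, by omega⟩) fun hq => hp ((hagree k hk).1 hq)
  refine ⟨fun k hk => ?_, ?_⟩
  · rw [hV k hk.le, hV (k + 1) hk, EReal.coe_le_coe_iff]
    exact h.strictMono.monotone (Fin.mk_le_mk.2 (by omega))
  · rw [hV M le_rfl]
    -- Otherwise one more `γ` would be at most `s M` than the number of entries from `γ` among the
    -- first `M + 1`.
    refine le_of_lt (not_le.1 fun hle => ?_)
    rw [extTop_le_coe_iff h.right_strictMono.monotone (by omega), h.symm.countLE_left, hc2 M le_rfl]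
      at hle
    simp only at hle
    omega

/-- The last symbol of either kind used before position `k` is one of the values bounded by `v`. For
a count of `0` there is no such symbol and `extTop` would be `⊤`, hence the premises `1 ≤ _`. -/
theorem extTop_count_le {p : ℕ → Prop} [DecidablePred p] {v : EReal} {k : ℕ}
    (hv : ∀ j < k, patternValue β γ p j ≤ v) :
    (1 ≤ Nat.count p k → extTop β (Nat.count p k) ≤ v) ∧
    (1 ≤ Nat.count (fun i => ¬ p i) k → extTop γ (Nat.count (fun i => ¬ p i) k) ≤ v) := by
  induction k with
  | zero => simp
  | succ k ih =>
    have h1 := ih fun j hj => hv j (by omega)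
    have h2 := hv k (by omega)
    unfold patternValue at h2
    split_ifs at h2 with hp
    · refine ⟨fun _ => h2, ?_⟩
      rw [Nat.count_succ, if_neg (not_not.2 hp)]
      exact h1.2
    · refine ⟨?_, fun _ => h2⟩
      rw [Nat.count_succ, if_neg hp]
      exact h1.1

/-- The next symbol of either kind from position `k` on either occurs within the following `d`
positions or is still the next one after them. The induction removes the last position of the
window. -/
theorem le_extTop_count {p : ℕ → Prop} [DecidablePred p] {v : EReal} {k d : ℕ}
    (hv : ∀ j, k ≤ j → j < k + d → v ≤ patternValue β γ p j)
    (h1 : v ≤ extTop β (Nat.count p (k + d) + 1))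
    (h2 : v ≤ extTop γ (Nat.count (fun i => ¬ p i) (k + d) + 1)) :
    v ≤ extTop β (Nat.count p k + 1) ∧ v ≤ extTop γ (Nat.count (fun i => ¬ p i) k + 1) := by
  induction d with
  | zero => exact ⟨h1, h2⟩
  | succ d ih =>
    have h3 := hv (k + d) (by omega) (by omega)
    rw [← add_assoc, Nat.count_succ] at h1 h2
    unfold patternValue at h3
    split_ifs at h1 h2 h3 with hp
    · rw [Nat.count_succ, if_pos hp] at h3
      exact ih (fun j hj hj' => hv j hj (by omega)) h3 h2
    · rw [Nat.count_succ, if_pos hp] at h3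
      exact ih (fun j hj hj' => hv j hj (by omega)) h1 h3

-- The value at position `k` of the pattern is squeezed between the symbols used so far and the next
-- ones. Hence exactly `k + 1` merged entries are at most this value, so it is the entry of rank `k`
-- and its origin decides `q k`.
omit [DecidablePred q] in
theorem IsMerge.agree_of_conditions (h : IsMerge s β γ τ q) {p : ℕ → Prop} [DecidablePred p]
    {M : ℕ} (hpM : p M) (hMb : Nat.count p (M + 1) ≤ b)
    (hstep : ∀ k < M, patternValue β γ p k ≤ patternValue β γ p (k + 1))
    (hlast : patternValue β γ p M ≤ extTop γ (Nat.count (fun i => ¬ p i) (M + 1) + 1)) :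
    ∀ k ≤ M, (q k ↔ p k) := by
  have hmono : ∀ j k, j ≤ k → k ≤ M → patternValue β γ p j ≤ patternValue β γ p k := by
    intro j k hjk
    induction k, hjk using Nat.le_induction with
    | base => exact fun _ => le_rfl
    | succ k _ ih => exact fun hk => (ih (by omega)).trans (hstep k (by omega))
  have hM1 : 1 ≤ Nat.count p (M + 1) := by rw [Nat.count_succ, if_pos hpM]; omega
  have hMV : patternValue β γ p M = extTop β (Nat.count p (M + 1)) := if_pos hpM
  -- Since `β_w` exists, all symbols up to position `M` are finite and are therefore actual entries.
  have hMtop : patternValue β γ p M < ⊤ := by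
    rw [hMV, extTop, dif_pos ⟨hM1, hMb⟩]
    exact EReal.coe_lt_top _
  intro k hk
  have hup := extTop_count_le (k := k + 1) (v := patternValue β γ p k)
    fun j hj => hmono j k (by omega) hk
  have hlow : patternValue β γ p k ≤ extTop β (Nat.count p (k + 1) + 1) ∧
      patternValue β γ p k ≤ extTop γ (Nat.count (fun i => ¬ p i) (k + 1) + 1) := by
    have hd : k + 1 + (M - k) = M + 1 := by omega
    refine le_extTop_count (d := M - k) (fun j hj hj' => hmono k j (by omega) (by omega)) ?_ ?_
    · rw [hd]
      exact (hmono k M hk le_rfl).trans (hMV ▸ extTop_le_extTop h.left_strictMono.monotone hM1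
        (Nat.le_succ _))
    · rw [hd]
      exact (hmono k M hk le_rfl).trans hlast
  have htop : patternValue β γ p k < ⊤ := (hmono k M hk le_rfl).trans_lt hMtop
  have hne : ∀ a c, β a ≠ γ c := fun a c hac => by
    rw [← h.left, ← h.right] at hac
    simpa using τ.injective (h.strictMono.injective hac)
  have hcounts : Nat.count p (k + 1) + Nat.count (fun i => ¬ p i) (k + 1) = k + 1 :=
    count_add_count_not p _
  -- it suffices to find the entry and to count the entries below it
  have key : ∀ t : Fin b ⊕ Fin m, patternValue β γ p k = s (τ t) →
      countLE β (s (τ t)) ≤ Nat.count p (k + 1) →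
      countLE γ (s (τ t)) ≤ Nat.count (fun i => ¬ p i) (k + 1) → (τ t : ℕ) = k := by
    intro t ht hβ hγ
    rw [ht] at hup
    have h1 : Nat.count p (k + 1) ≤ countLE β (s (τ t)) := by
      rcases Nat.eq_zero_or_pos (Nat.count p (k + 1)) with h0 | h0
      · omega
      · exact (extTop_le_coe_iff h.left_strictMono.monotone h0).1 (hup.1 h0)
    have h2 : Nat.count (fun i => ¬ p i) (k + 1) ≤ countLE γ (s (τ t)) := by
      rcases Nat.eq_zero_or_pos (Nat.count (fun i => ¬ p i) (k + 1)) with h0 | h0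
      · omega
      · exact (extTop_le_coe_iff h.right_strictMono.monotone h0).1 (hup.2 h0)
    have h3 := h.countLE_add (s (τ t))
    rw [countLE_self h.strictMono] at h3
    omega
  by_cases hp : p k
  · have hV : patternValue β γ p k = extTop β (Nat.count p (k + 1)) := if_pos hp
    obtain ⟨a, ha⟩ := exists_of_extTop_lt_top (hV ▸ htop)
    rw [← ha, extTop_succ] at hV
    have := key (Sum.inl a) (by rw [hV, h.left]) (by rw [h.left, countLE_self h.left_strictMono, ha])
      (by
        rw [h.left]
        -- One `γ` too many would be squeezed to equality with the present `β`, but the merge has no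
        -- ties.
        by_contra! hlt
        have h1 := (extTop_le_coe_iff h.right_strictMono.monotone (by omega)).2 hlt
        obtain ⟨c, hc⟩ := exists_of_extTop_lt_top (h1.trans_lt (EReal.coe_lt_top _))
        have h2 := h1.antisymm (hV ▸ hlow.2)
        rw [← hc, extTop_succ, EReal.coe_eq_coe_iff] at h2
        exact hne a c h2.symm)
    exact ⟨fun _ => hp, fun _ => this ▸ h.left_iff a⟩
  · have hV : patternValue β γ p k = extTop γ (Nat.count (fun i => ¬ p i) (k + 1)) := if_neg hp
    obtain ⟨c, hc⟩ := exists_of_extTop_lt_top (hV ▸ htop)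
    rw [← hc, extTop_succ] at hV
    have := key (Sum.inr c) (by rw [hV, h.right])
      (by
        rw [h.right]
        by_contra! hlt
        have h1 := (extTop_le_coe_iff h.left_strictMono.monotone (by omega)).2 hlt
        obtain ⟨a, ha⟩ := exists_of_extTop_lt_top (h1.trans_lt (EReal.coe_lt_top _))
        have h2 := h1.antisymm (hV ▸ hlow.1)
        rw [← ha, extTop_succ, EReal.coe_eq_coe_iff] at h2
        exact hne a c h2)
      (by rw [h.right, countLE_self h.right_strictMono, hc])
    exact ⟨fun hq => absurd (this ▸ hq) (h.right_iff c), fun h' => absurd h' hp⟩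

end

/-! ### The conditions of a pattern -/

/-- The support of a pattern, as a predicate on the positions `k = 0, 1, …`. -/
def patternAt {n : ℕ} (ρ : Fin n → ZMod 2) (k : ℕ) : Prop := ∃ h : k < n, ρ ⟨k, h⟩ ≠ 0

instance {n : ℕ} (ρ : Fin n → ZMod 2) : DecidablePred (patternAt ρ) := fun k =>
  inferInstanceAs (Decidable (∃ h : k < n, ρ ⟨k, h⟩ ≠ 0))

theorem patternAt_val {n : ℕ} (ρ : Fin n → ZMod 2) (k : Fin n) : patternAt ρ k ↔ ρ k ≠ 0 :=
  ⟨fun h => h.2, fun h => ⟨k.2, h⟩⟩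

theorem card_filter_le_eq_count {n : ℕ} (r : Fin n → Prop) [DecidablePred r] (p : ℕ → Prop)
    [DecidablePred p] (h : ∀ i : Fin n, p i ↔ r i) (k : Fin n) :
    (univ.filter fun i => i ≤ k ∧ r i).card = Nat.count p (k + 1) := by
  rw [Nat.count_eq_card_filter_range]
  refine card_bij (fun i _ => (i : ℕ)) ?_ (fun _ _ _ _ h => Fin.ext h) ?_
  · intro i hi
    simp only [mem_filter, mem_univ, true_and, mem_range, Fin.le_def] at hi ⊢
    exact ⟨by omega, (h i).2 hi.2⟩
  · intro i hi
    simp only [mem_filter, mem_range] at hi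
    refine ⟨⟨i, by omega⟩, ?_, rfl⟩
    simp only [mem_filter, mem_univ, true_and, Fin.le_def]
    exact ⟨by omega, (h ⟨i, by omega⟩).1 hi.2⟩

/-- The value of a symbol, given the sorted reliabilities. -/
def OSVar.fullValue {b m : ℕ} (β : Fin b → ℝ) (γ : Fin m → ℝ) : OSVar → EReal
  | .beta i => extTop β i
  | .gamma j => extTop γ j

theorem fullValue_varAt {n b m : ℕ} (β : Fin b → ℝ) (γ : Fin m → ℝ) (ρ : Fin n → ZMod 2)
    (k : Fin n) : (varAt ρ k).fullValue β γ = patternValue β γ (patternAt ρ) k := by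
  unfold varAt patternValue
  rw [card_filter_le_eq_count (fun i => ρ i ≠ 0) (patternAt ρ) (patternAt_val ρ),
    card_filter_le_eq_count (fun i => ρ i = 0) (fun i => ¬ patternAt ρ i)
      fun i => by rw [patternAt_val, not_not]]
  by_cases h : ρ k ≠ 0
  · rw [if_pos h, if_pos ((patternAt_val ρ k).2 h)]
    rfl
  · rw [if_neg h, if_neg fun h' => h ((patternAt_val ρ k).1 h')]
    rfl

theorem exists_maxPos {n : ℕ} {ρ : Fin n → ZMod 2} (hρ : ρ ≠ 0) :
    ∃ M : Fin n, maxPos ρ = M + 1 ∧ ρ M ≠ 0 ∧ hammingNorm ρ = Nat.count (patternAt ρ) (M + 1) := by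
  obtain ⟨k, hk⟩ := Function.ne_iff.1 hρ
  obtain ⟨M, hM, hsup⟩ := exists_mem_eq_sup (univ.filter fun i => ρ i ≠ 0)
    ⟨k, mem_filter.2 ⟨mem_univ _, hk⟩⟩ fun i => (i : ℕ) + 1
  refine ⟨M, hsup, (mem_filter.1 hM).2, ?_⟩
  rw [← card_filter_le_eq_count (fun i => ρ i ≠ 0) (patternAt ρ) (patternAt_val ρ), hammingNorm]
  congr 1
  ext i
  simp only [mem_filter, mem_univ, true_and]
  refine (and_iff_right_of_imp fun hi => ?_).symm
  have h1 : (i : ℕ) + 1 ≤ maxPos ρ :=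
    le_sup (f := fun i : Fin n => (i : ℕ) + 1) (mem_filter.2 ⟨mem_univ i, hi⟩)
  have h2 : maxPos ρ = M + 1 := hsup
  exact Fin.le_def.2 (by omega)

/-- Neighbouring positions with equal entries carry consecutive symbols of one kind, whose
comparison is automatic for sorted samples. The index `maxPos ρ - hammingNorm ρ + 1` belongs to the
first `γ` not used by the pattern. -/
theorem forall_constraints_iff {n b m : ℕ} {β : Fin b → ℝ} {γ : Fin m → ℝ} (hβ : Monotone β)
    (hγ : Monotone γ) {ρ : Fin n → ZMod 2} {M : Fin n} (hM : maxPos ρ = M + 1) (hρM : ρ M ≠ 0)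
    (hw : hammingNorm ρ = Nat.count (patternAt ρ) (M + 1)) :
    (∀ c ∈ constraints ρ, c.1.fullValue β γ ≤ c.2.fullValue β γ) ↔
      (∀ k < (M : ℕ), patternValue β γ (patternAt ρ) k ≤ patternValue β γ (patternAt ρ) (k + 1)) ∧
      patternValue β γ (patternAt ρ) M ≤
        extTop γ (Nat.count (fun i => ¬ patternAt ρ i) (M + 1) + 1) := by
  have hlast : maxPos ρ - hammingNorm ρ = Nat.count (fun i => ¬ patternAt ρ i) (M + 1) := by
    have := count_add_count_not (patternAt ρ) (M + 1)
    omega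
  have hVM : patternValue β γ (patternAt ρ) M = extTop β (Nat.count (patternAt ρ) (M + 1)) :=
    if_pos ((patternAt_val ρ M).2 hρM)
  rw [constraints, forall_mem_insert, and_comm, hlast, hw, hVM]
  refine and_congr_left fun _ => ?_
  simp only [mem_image, mem_filter, mem_univ, true_and, Prod.exists]
  constructor
  · intro h k hk
    have hkn : k + 1 < n := by omega
    by_cases hkk : ρ ⟨k, by omega⟩ = ρ ⟨k + 1, by omega⟩
    · have hiff : patternAt ρ k ↔ patternAt ρ (k + 1) := by
        have h1 := patternAt_val ρ ⟨k, by omega⟩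
        have h2 := patternAt_val ρ ⟨k + 1, by omega⟩
        rw [hkk] at h1
        exact h1.trans h2.symm
      unfold patternValue
      by_cases hp : patternAt ρ k
      · rw [if_pos hp, if_pos (hiff.1 hp)]
        refine extTop_le_extTop hβ ?_ (Nat.count_monotone _ (Nat.le_succ _))
        rw [Nat.count_succ, if_pos hp]
        omega
      · rw [if_neg hp, if_neg (fun h => hp (hiff.2 h))]
        refine extTop_le_extTop hγ ?_ (Nat.count_monotone _ (Nat.le_succ _))
        rw [Nat.count_succ, if_pos hp]
        omega
    · have := h _ ⟨⟨k, by omega⟩, ⟨k + 1, by omega⟩,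
        ⟨rfl, by simp only; omega, hkk⟩, rfl⟩
      rwa [fullValue_varAt, fullValue_varAt] at this
  · rintro h c ⟨i, j, ⟨hij, hj, -⟩, rfl⟩
    rw [fullValue_varAt, fullValue_varAt, ← hij]
    exact h i (by omega)

theorem betaIdx_subset {n : ℕ} (ρ : Fin n → ZMod 2) (b : ℕ) : betaIdx ρ b ⊆ Icc 1 b :=
  filter_subset _ _

theorem gammaIdx_subset {n : ℕ} (ρ : Fin n → ZMod 2) (m : ℕ) : gammaIdx ρ m ⊆ Icc 1 m :=
  filter_subset _ _

/-- A symbol that occurs in the conditions is missing from the index set only if it is out of range,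
so the two default values `⊤` agree. -/
theorem value_eq_fullValue {n b m : ℕ} (β : Fin b → ℝ) (γ : Fin m → ℝ) {ρ : Fin n → ZMod 2}
    {c : OSVar × OSVar} (hc : c ∈ constraints ρ) {v : OSVar} (hv : c.1 = v ∨ c.2 = v) :
    v.value (fun i : betaIdx ρ b => β (idxPos (betaIdx_subset ρ b) i))
      (fun j : gammaIdx ρ m => γ (idxPos (gammaIdx_subset ρ m) j)) = v.fullValue β γ := by
  rcases v with i | j
  · simp only [OSVar.value, OSVar.fullValue, extTop]
    by_cases hi : 1 ≤ i ∧ i ≤ b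
    · rw [dif_pos (show i ∈ betaIdx ρ b from mem_filter.2 ⟨mem_Icc.2 hi, c, hc, hv⟩), dif_pos hi]
      rfl
    · rw [dif_neg fun h => hi (mem_Icc.1 (betaIdx_subset ρ b h)), dif_neg hi]
  · simp only [OSVar.value, OSVar.fullValue, extTop]
    by_cases hj : 1 ≤ j ∧ j ≤ m
    · rw [dif_pos (show j ∈ gammaIdx ρ m from mem_filter.2 ⟨mem_Icc.2 hj, c, hc, hv⟩), dif_pos hj]
      rfl
    · rw [dif_neg fun h => hj (mem_Icc.1 (gammaIdx_subset ρ m h)), dif_neg hj]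

/-- The first errors follow the pattern if and only if the ordered reliabilities fulfil the
conditions. -/
theorem IsMerge.mem_region_iff {n b m : ℕ} {s : Fin n → ℝ} {β : Fin b → ℝ} {γ : Fin m → ℝ}
    {τ : Fin b ⊕ Fin m ≃ Fin n} {ε : Fin n → ZMod 2} (h : IsMerge s β γ τ (patternAt ε))
    (hβ : ∀ a, 0 ≤ β a) (hγ : ∀ a, 0 ≤ γ a) {ρ : Fin n → ZMod 2} (hρ : ρ ≠ 0)
    (hb : hammingNorm ρ ≤ b) :
    ((fun i => β (idxPos (betaIdx_subset ρ b) i), fun j => γ (idxPos (gammaIdx_subset ρ m) j)) :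
      (betaIdx ρ b → ℝ) × (gammaIdx ρ m → ℝ)) ∈ region ρ b m ↔
      ∀ i : Fin n, (i : ℕ) + 1 ≤ maxPos ρ → ε i = ρ i := by
  obtain ⟨M, hM, hρM, hw⟩ := exists_maxPos hρ
  have h1 : ((fun i => β (idxPos (betaIdx_subset ρ b) i),
      fun j => γ (idxPos (gammaIdx_subset ρ m) j)) :
      (betaIdx ρ b → ℝ) × (gammaIdx ρ m → ℝ)) ∈ region ρ b m ↔
      ∀ c ∈ constraints ρ, c.1.fullValue β γ ≤ c.2.fullValue β γ := by
    simp only [region, Set.mem_ofPred_eq]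
    refine (and_iff_right fun _ => hβ _).trans ((and_iff_right fun _ => hγ _).trans
      (forall₂_congr fun c hc => ?_))
    rw [value_eq_fullValue β γ hc (Or.inl rfl), value_eq_fullValue β γ hc (Or.inr rfl)]
  have h2 : (∀ i : Fin n, (i : ℕ) + 1 ≤ maxPos ρ → ε i = ρ i) ↔
      ∀ k ≤ (M : ℕ), (patternAt ε k ↔ patternAt ρ k) := by
    have hz : ∀ x y : ZMod 2, x = y ↔ (x ≠ 0 ↔ y ≠ 0) := by decide
    constructor
    · intro h k hk
      have h3 := h ⟨k, by omega⟩ (by simp only; omega)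
      exact (patternAt_val ε ⟨k, by omega⟩).trans (((hz _ _).1 h3).trans
        (patternAt_val ρ ⟨k, by omega⟩).symm)
    · intro h i hi
      rw [hz, ← patternAt_val, ← patternAt_val]
      exact h i (by omega)
  rw [h1, h2, forall_constraints_iff h.left_strictMono.monotone h.right_strictMono.monotone hM hρM hw]
  exact ⟨fun hc => h.agree_of_conditions ((patternAt_val ρ M).2 hρM) (hw ▸ hb) hc.1 hc.2,
    fun hc => h.conditions_of_agree M.2 hc⟩

/-! ### Splitting a Gaussian vector by signs -/

/-- The positions of the negative entries. -/
def negSet {n : ℕ} (v : Fin n → ℝ) : Finset (Fin n) := univ.filter fun i => v i < 0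

/-- The absolute values at the positions of either kind. -/
def absSplit {n b m : ℕ} (e : Fin b ⊕ Fin m ≃ Fin n) (v : Fin n → ℝ) :
    (Fin b → ℝ) × (Fin m → ℝ) :=
  (fun a => |v (e (Sum.inl a))|, fun c => |v (e (Sum.inr c))|)

/-- An enumeration of a set of positions and of its complement. -/
def splitEquiv {n b : ℕ} (S : {S : Finset (Fin n) // S.card = b}) :
    Fin b ⊕ Fin (n - b) ≃ Fin n :=
  finSumEquivOfFinset S.2 (by rw [card_compl, S.2, Fintype.card_fin])

theorem splitEquiv_inl_mem {n b : ℕ} (S : {S : Finset (Fin n) // S.card = b}) (a : Fin b) :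
    splitEquiv S (Sum.inl a) ∈ S.1 := by
  rw [splitEquiv, finSumEquivOfFinset_inl]
  exact orderEmbOfFin_mem _ _ _

theorem splitEquiv_inr_notMem {n b : ℕ} (S : {S : Finset (Fin n) // S.card = b})
    (c : Fin (n - b)) : splitEquiv S (Sum.inr c) ∉ S.1 := by
  rw [splitEquiv, finSumEquivOfFinset_inr, ← mem_compl]
  exact orderEmbOfFin_mem _ _ _

theorem negSet_eq_iff {n b : ℕ} (S : {S : Finset (Fin n) // S.card = b}) (v : Fin n → ℝ) :
    negSet v = S.1 ↔ (∀ a, v (splitEquiv S (Sum.inl a)) < 0) ∧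
      ∀ c, 0 ≤ v (splitEquiv S (Sum.inr c)) := by
  constructor
  · intro h
    refine ⟨fun a => ?_, fun c => not_lt.1 fun hc => ?_⟩
    · have := splitEquiv_inl_mem S a
      rw [← h] at this
      exact (mem_filter.1 this).2
    · refine splitEquiv_inr_notMem S c ?_
      rw [← h]
      exact mem_filter.2 ⟨mem_univ _, hc⟩
  · rintro ⟨h1, h2⟩
    ext i
    simp only [negSet, mem_filter, mem_univ, true_and]
    obtain ⟨a | c, rfl⟩ := (splitEquiv S).surjective i
    · exact ⟨fun _ => splitEquiv_inl_mem S a, fun _ => h1 a⟩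
    · exact ⟨fun h => absurd h (h2 c).not_gt, fun h => absurd h (splitEquiv_inr_notMem S c)⟩

theorem measurable_pi_abs (ι : Type*) : Measurable fun (x : ι → ℝ) i => |x i| :=
  measurable_pi_lambda _ fun i => (measurable_pi_apply i).abs

/-- The joint law of the reliabilities of the erroneous and of the correct positions. -/
def relLaw (σ : ℝ) (b m : ℕ) : Measure ((Fin b → ℝ) × (Fin m → ℝ)) :=
  (Measure.pi fun _ => truncLaw σ (-1)).prod (Measure.pi fun _ => truncLaw σ 1)

/-- Prescribing the signs restricts each coordinate to a half-line, so the measure remains a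
product; taking absolute values coordinatewise gives multiples of the truncated laws. The result
depends on `S` through its size only. -/
theorem gaussian_measure_negSet {σ : ℝ} (hσ : 0 < σ) {n b : ℕ}
    (S : {S : Finset (Fin n) // S.card = b}) {A : Set ((Fin b → ℝ) × (Fin (n - b) → ℝ))}
    (hA : MeasurableSet A) :
    MeasurableSet {v | negSet v = S.1 ∧ absSplit (splitEquiv S) v ∈ A} ∧
    (Measure.pi fun _ : Fin n => gaussianReal 1 (Real.toNNReal (σ ^ 2)))
      {v | negSet v = S.1 ∧ absSplit (splitEquiv S) v ∈ A} =
    ENNReal.ofReal (tailQ σ 1) ^ b * ENNReal.ofReal (1 - tailQ σ 1) ^ (n - b) *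
      relLaw σ b (n - b) A := by
  have := (hasDensityCDF_truncLaw hσ (-1)).prob
  have := (hasDensityCDF_truncLaw hσ 1).prob
  set g := gaussianReal 1 (Real.toNNReal (σ ^ 2))
  set absMap : (Fin b → ℝ) × (Fin (n - b) → ℝ) → (Fin b → ℝ) × (Fin (n - b) → ℝ) :=
    Prod.map (fun x i => |x i|) (fun y i => |y i|)
  have habs : Measurable absMap := (measurable_pi_abs _).prodMap (measurable_pi_abs _)
  set Q : Set ((Fin b → ℝ) × (Fin (n - b) → ℝ)) :=
    (Set.univ.pi fun _ => Set.Iio 0) ×ˢ (Set.univ.pi fun _ => Set.Ici 0)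
  have hQ : MeasurableSet Q := (MeasurableSet.univ_pi fun _ => measurableSet_Iio).prod
    (MeasurableSet.univ_pi fun _ => measurableSet_Ici)
  have hsplit := measurePreserving_split g (splitEquiv S)
  have hset : {v | negSet v = S.1 ∧ absSplit (splitEquiv S) v ∈ A} =
      (fun x : Fin n → ℝ => (fun i => x (splitEquiv S (Sum.inl i)),
        fun k => x (splitEquiv S (Sum.inr k)))) ⁻¹' (absMap ⁻¹' A ∩ Q) := by
    ext v
    simp only [Set.mem_ofPred_eq, Set.mem_preimage, Set.mem_inter_iff, negSet_eq_iff]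
    rw [and_comm]
    refine and_congr Iff.rfl ?_
    simp only [Q, Set.mem_prod, Set.mem_univ_pi, Set.mem_Iio, Set.mem_Ici]
  rw [hset]
  refine ⟨hsplit.measurable ((habs hA).inter hQ), ?_⟩
  rw [hsplit.measure_preimage ((habs hA).inter hQ).nullMeasurableSet,
    ← Measure.restrict_apply (habs hA), ← Measure.map_apply habs hA, ← Measure.prod_restrict,
    Measure.restrict_pi_pi, Measure.restrict_pi_pi,
    ← Measure.map_prod_map _ _ (measurable_pi_abs _) (measurable_pi_abs _)]
  have hfin1 : IsFiniteMeasure ((g.restrict (Set.Iio 0)).map fun x => |x|) := inferInstance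
  have hfin2 : IsFiniteMeasure ((g.restrict (Set.Ici 0)).map fun x => |x|) := inferInstance
  rw [Measure.pi_map_pi (f := fun _ x => |x|) fun _ => measurable_abs.aemeasurable,
    Measure.pi_map_pi (f := fun _ x => |x|) fun _ => measurable_abs.aemeasurable,
    map_abs_restrict_Iio hσ, map_abs_restrict_Ici hσ, pi_smul_const _ ENNReal.ofReal_ne_top,
    pi_smul_const _ ENNReal.ofReal_ne_top, Measure.prod_smul_left, Measure.prod_smul_right,
    Measure.smul_apply, Measure.smul_apply, Fintype.card_fin, Fintype.card_fin, smul_eq_mul,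
    smul_eq_mul, ← mul_assoc]
  rfl

/-- The vectors with `b` negative entries whose absolute values, split by sign, lie in `A`. -/
def splitEvent {n b : ℕ} (A : Set ((Fin b → ℝ) × (Fin (n - b) → ℝ))) : Set (Fin n → ℝ) :=
  ⋃ S : {S : Finset (Fin n) // S.card = b}, {v | negSet v = S.1 ∧ absSplit (splitEquiv S) v ∈ A}

theorem measurableSet_splitEvent {n b : ℕ} {A : Set ((Fin b → ℝ) × (Fin (n - b) → ℝ))}
    (hA : MeasurableSet A) : MeasurableSet (splitEvent A) :=
  -- Measurability does not involve the variance, so `σ = 1` serves.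
  MeasurableSet.iUnion fun S => (gaussian_measure_negSet one_pos S hA).1

theorem gaussian_measure_splitEvent {σ : ℝ} (hσ : 0 < σ) {n b : ℕ}
    {A : Set ((Fin b → ℝ) × (Fin (n - b) → ℝ))} (hA : MeasurableSet A) :
    (Measure.pi fun _ : Fin n => gaussianReal 1 (Real.toNNReal (σ ^ 2))) (splitEvent A) =
      (n.choose b * (ENNReal.ofReal (tailQ σ 1) ^ b * ENNReal.ofReal (1 - tailQ σ 1) ^ (n - b))) *
        relLaw σ b (n - b) A := by
  rw [splitEvent, measure_iUnion _ fun S => (gaussian_measure_negSet hσ S hA).1, tsum_fintype,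
    sum_congr rfl fun S _ => (gaussian_measure_negSet hσ S hA).2, sum_const, card_univ,
    Fintype.card_finset_len, Fintype.card_fin, nsmul_eq_mul]
  · simp only [mul_assoc]
  intro S S' hne
  refine Set.disjoint_left.2 fun v hv hv' => hne (Subtype.ext ?_)
  exact hv.1.symm.trans hv'.1

/-- A vector with pairwise distinct absolute values, sorted by absolute value, is the merge of the
sorted absolute values of its negative and of its non-negative entries. -/
theorem isMerge_absSplit {n b : ℕ} {v : Fin n → ℝ} (hv : Function.Injective fun i => |v i|)
    {π : Equiv.Perm (Fin n)} (hπ : Monotone fun k => |v (π k)|)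
    {S : {S : Finset (Fin n) // S.card = b}} (hS : negSet v = S.1) {ε : Fin n → ZMod 2}
    (hε : ∀ k, ε k = if v (π k) < 0 then 1 else 0) :
    IsMerge (fun k => |v (π k)|) (orderStat (absSplit (splitEquiv S) v).1)
      (orderStat (absSplit (splitEquiv S) v).2)
      ((Equiv.sumCongr (Tuple.sort (absSplit (splitEquiv S) v).1)
        (Tuple.sort (absSplit (splitEquiv S) v).2)).trans ((splitEquiv S).trans π.symm))
      (patternAt ε) := by
  obtain ⟨h1, h2⟩ := (negSet_eq_iff S v).1 hS
  refine ⟨hπ.strictMono_of_injective (hv.comp π.injective), strictMono_comp_sort ?_,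
    strictMono_comp_sort ?_, fun a => ?_, fun c => ?_, fun a => ?_, fun c => ?_⟩
  · exact hv.comp ((splitEquiv S).injective.comp Sum.inl_injective)
  · exact hv.comp ((splitEquiv S).injective.comp Sum.inr_injective)
  · simp [orderStat, absSplit]
  · simp [orderStat, absSplit]
  · rw [patternAt_val, hε]
    simp [h1]
  · rw [patternAt_val, hε]
    simp [h2]

/-! ### The law of the ordered reliabilities -/

/-- The ordered reliabilities that occur in the conditions. -/
def chosenStats {n : ℕ} (ρ : Fin n → ZMod 2) (b m : ℕ) (p : (Fin b → ℝ) × (Fin m → ℝ)) :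
    (betaIdx ρ b → ℝ) × (gammaIdx ρ m → ℝ) :=
  (fun i => orderStat p.1 (idxPos (betaIdx_subset ρ b) i),
    fun j => orderStat p.2 (idxPos (gammaIdx_subset ρ m) j))

theorem measurable_chosenStats {n : ℕ} (ρ : Fin n → ZMod 2) (b m : ℕ) :
    Measurable (chosenStats ρ b m) :=
  (measurable_pi_lambda _ fun _ => (measurable_orderStat _).comp measurable_fst).prodMk
    (measurable_pi_lambda _ fun _ => (measurable_orderStat _).comp measurable_snd)

theorem map_chosenStats {σ : ℝ} (hσ : 0 < σ) {n : ℕ} (ρ : Fin n → ZMod 2) (b m : ℕ) :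
    (relLaw σ b m).map (chosenStats ρ b m) =
      volume.withDensity fun p => ENNReal.ofReal
        (jointOSDensity (fe σ) (Fe σ) b (betaIdx ρ b) p.1 *
          jointOSDensity (fc σ) (Fc σ) m (gammaIdx ρ m) p.2) := by
  have he := hasDensityCDF_truncLaw hσ (-1)
  have hc := hasDensityCDF_truncLaw hσ 1
  have := he.prob
  have := hc.prob
  have hm1 : Measurable fun (x : Fin b → ℝ) i => orderStat x (idxPos (betaIdx_subset ρ b) i) :=
    measurable_pi_lambda _ fun _ => measurable_orderStat _
  have hm2 : Measurable fun (x : Fin m → ℝ) i => orderStat x (idxPos (gammaIdx_subset ρ m) i) :=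
    measurable_pi_lambda _ fun _ => measurable_orderStat _
  rw [fe_eq, Fe_eq, fc_eq hσ, Fc_eq hσ]
  simp only [ENNReal.ofReal_mul (he.jointOSDensity_nonneg _ _ _)]
  rw [Measure.volume_eq_prod, ← prod_withDensity
    (he.measurable_jointOSDensity b (betaIdx ρ b)).ennreal_ofReal
    (hc.measurable_jointOSDensity m (gammaIdx ρ m)).ennreal_ofReal,
    ← he.map_orderStat (betaIdx_subset ρ b), ← hc.map_orderStat (gammaIdx_subset ρ m),
    Measure.map_prod_map _ _ hm1 hm2]
  rfl

theorem measurable_value {I J : Finset ℕ} (v : OSVar) :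
    Measurable fun p : (I → ℝ) × (J → ℝ) => v.value p.1 p.2 := by
  rcases v with i | j <;> simp only [OSVar.value] <;> split_ifs
  · exact measurable_coe_real_ereal.comp ((measurable_pi_apply _).comp measurable_fst)
  · exact measurable_const
  · exact measurable_coe_real_ereal.comp ((measurable_pi_apply _).comp measurable_snd)
  · exact measurable_const

theorem measurableSet_region {n : ℕ} (ρ : Fin n → ZMod 2) (b m : ℕ) :
    MeasurableSet (region ρ b m) := by
  have h : region ρ b m = ({p | 0 ≤ p.1} ∩ {p | 0 ≤ p.2}) ∩
      ⋂ c ∈ constraints ρ, {p | c.1.value p.1 p.2 ≤ c.2.value p.1 p.2} := by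
    ext p
    simp only [region, Set.mem_ofPred_eq, Set.mem_inter_iff, Set.mem_iInter, and_assoc]
  rw [h]
  refine ((measurable_fst measurableSet_Ici).inter (measurable_snd measurableSet_Ici)).inter ?_
  exact Finset.measurableSet_biInter _ fun c _ =>
    measurableSet_le (measurable_value _) (measurable_value _)

/-! ### Reduction to the transmission of the zero word -/

/-- The channel output multiplied by the transmitted symbols. -/
def alignedOutput {n : ℕ} (c : Fin n → ZMod 2) (z : Fin n → ℝ) : Fin n → ℝ :=
  fun i => 1 + bpsk (c i) * z i

theorem measurable_alignedOutput (n : ℕ) :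
    Measurable fun p : (Fin n → ZMod 2) × (Fin n → ℝ) => alignedOutput p.1 p.2 := by
  refine measurable_pi_lambda _ fun i => measurable_const.add (Measurable.mul ?_ ?_)
  · exact (measurable_of_countable bpsk).comp ((measurable_pi_apply i).comp measurable_fst)
  · exact (measurable_pi_apply i).comp measurable_snd

theorem bpsk_eq_or (c : ZMod 2) : bpsk c = 1 ∨ bpsk c = -1 := by
  unfold bpsk
  split_ifs <;> simp

theorem gaussianReal_map_align (σ : ℝ) (c : ZMod 2) :
    (gaussianReal 0 (Real.toNNReal (σ ^ 2))).map (fun z => 1 + bpsk c * z) =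
      gaussianReal 1 (Real.toNNReal (σ ^ 2)) := by
  rcases bpsk_eq_or c with h | h
  · simpa [h] using gaussianReal_map_const_add (μ := 0) (v := Real.toNNReal (σ ^ 2)) 1
  · have h1 : (fun z : ℝ => 1 + bpsk c * z) = fun z => 1 - z := by
      funext z; rw [h]; ring
    rw [h1, gaussianReal_map_const_sub, sub_zero]

/-- For each fixed word the aligned output has the same Gaussian law, by the symmetry of the noise;
averaging over an arbitrary law of the word changes nothing. -/
theorem map_alignedOutput (σ : ℝ) {n : ℕ} (κ : Measure (Fin n → ZMod 2)) [IsProbabilityMeasure κ] :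
    (κ.prod (Measure.pi fun _ : Fin n => gaussianReal 0 (Real.toNNReal (σ ^ 2)))).map
      (fun p => alignedOutput p.1 p.2) =
      Measure.pi fun _ : Fin n => gaussianReal 1 (Real.toNNReal (σ ^ 2)) := by
  have h := (MeasurePreserving.id κ).skew_product (g := alignedOutput) (measurable_alignedOutput n)
    (μc := Measure.pi fun _ : Fin n => gaussianReal 0 (Real.toNNReal (σ ^ 2)))
    (μd := Measure.pi fun _ : Fin n => gaussianReal 1 (Real.toNNReal (σ ^ 2)))
    (Filter.Eventually.of_forall fun c => by
      have : ∀ i : Fin n, IsProbabilityMeasure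
          ((gaussianReal 0 (Real.toNNReal (σ ^ 2))).map fun z => 1 + bpsk (c i) * z) := fun i => by
        rw [gaussianReal_map_align]; infer_instance
      unfold alignedOutput
      rw [Measure.pi_map_pi (f := fun i z => 1 + bpsk (c i) * z)
        fun i => (measurable_const.add (measurable_const.mul measurable_id)).aemeasurable]
      simp only [gaussianReal_map_align])
  exact (measurePreserving_snd.comp h).map_eq

theorem errorVector_apply {n : ℕ} (σ : ℝ) (c : Fin n → ZMod 2) (z : Fin n → ℝ)
    (h : ∀ i, alignedOutput c z i ≠ 0) (k : Fin n) :
    errorVector σ c (channelOutput c z) k =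
      if alignedOutput c z (Tuple.sort (reliability σ (channelOutput c z)) k) < 0 then 1 else 0 := by
  unfold errorVector
  generalize Tuple.sort (reliability σ (channelOutput c z)) k = i
  have hi : 1 + bpsk (c i) * z i ≠ 0 := h i
  change c i + (if bpsk (c i) + z i < 0 then 1 else 0) =
    if 1 + bpsk (c i) * z i < 0 then 1 else 0
  have h2 : ∀ a : ZMod 2, a ≠ 0 → a = 1 := by decide
  have h3 : (1 : ZMod 2) + 1 = 0 := by decide
  by_cases hc : c i = 0
  · simp [hc, bpsk]
  -- Here the aligned output is the negative of the channel output. An output of `0` is decided as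
  -- `0` and is then an error, although the aligned output is not negative; the hypothesis `h`
  -- excludes this case.
  · have hb : bpsk (c i) = -1 := if_neg hc
    rw [hb] at hi ⊢
    rw [h2 _ hc]
    rcases lt_or_gt_of_ne hi with hlt | hgt
    · rw [if_neg (by linarith), if_pos hlt, add_zero]
    · rw [if_pos (by linarith), if_neg (by linarith), h3]

theorem monotone_abs_alignedOutput {n : ℕ} {σ : ℝ} (hσ : 0 < σ) (c : Fin n → ZMod 2)
    (z : Fin n → ℝ) : Monotone fun k =>
      |alignedOutput c z (Tuple.sort (reliability σ (channelOutput c z)) k)| := by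
  have h : ∀ i, |alignedOutput c z i| = σ ^ 2 / 2 * reliability σ (channelOutput c z) i := by
    intro i
    have h1 : |channelOutput c z i| = |alignedOutput c z i| := by
      simp only [channelOutput, alignedOutput]
      rcases bpsk_eq_or (c i) with h | h
      · rw [h, one_mul]
      · rw [h, ← abs_neg]
        congr 1
        ring
    rw [reliability, llr, abs_mul, abs_of_pos (by positivity : (0 : ℝ) < 2 / σ ^ 2), h1]
    field_simp
  simp only [h]
  exact fun i j hij => mul_le_mul_of_nonneg_left
    (Tuple.monotone_sort (reliability σ (channelOutput c z)) hij) (by positivity)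

theorem hammingNorm_eq_card_negSet {n : ℕ} {v : Fin n → ℝ} (π : Equiv.Perm (Fin n))
    {ε : Fin n → ZMod 2} (hε : ∀ k, ε k = if v (π k) < 0 then 1 else 0) :
    hammingNorm ε = (negSet v).card := by
  rw [hammingNorm, negSet]
  refine card_equiv π fun k => ?_
  simp only [mem_filter, mem_univ, true_and, hε]
  split_ifs with h <;> simp [h]

/-- For almost all outputs, the event in terms of the signs and the absolute values. -/
theorem mem_splitEvent_region_iff {n b : ℕ} {v : Fin n → ℝ}
    (hv : Function.Injective fun i => |v i|) {π : Equiv.Perm (Fin n)}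
    (hπ : Monotone fun k => |v (π k)|) {ε : Fin n → ZMod 2}
    (hε : ∀ k, ε k = if v (π k) < 0 then 1 else 0) {ρ : Fin n → ZMod 2} (hρ : ρ ≠ 0)
    (hb : hammingNorm ρ ≤ b) :
    v ∈ splitEvent (chosenStats ρ b (n - b) ⁻¹' region ρ b (n - b)) ↔
      hammingNorm ε = b ∧ ∀ i : Fin n, (i : ℕ) + 1 ≤ maxPos ρ → ε i = ρ i := by
  rw [hammingNorm_eq_card_negSet π hε, splitEvent, Set.mem_iUnion]
  have hiff : ∀ S : {S : Finset (Fin n) // S.card = b}, negSet v = S.1 →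
      (absSplit (splitEquiv S) v ∈ chosenStats ρ b (n - b) ⁻¹' region ρ b (n - b) ↔
        ∀ i : Fin n, (i : ℕ) + 1 ≤ maxPos ρ → ε i = ρ i) := fun S hS =>
    (isMerge_absSplit hv hπ hS hε).mem_region_iff (fun a => abs_nonneg _) (fun c => abs_nonneg _)
      hρ hb
  constructor
  · rintro ⟨S, hS, hA⟩
    exact ⟨hS ▸ S.2, (hiff S hS).1 hA⟩
  · rintro ⟨hcard, h⟩
    exact ⟨⟨negSet v, hcard⟩, rfl, (hiff ⟨negSet v, hcard⟩ rfl).2 h⟩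

theorem mem_splitEvent_univ_iff {n b : ℕ} {v : Fin n → ℝ} :
    v ∈ splitEvent (b := b) Set.univ ↔ (negSet v).card = b := by
  rw [splitEvent, Set.mem_iUnion]
  exact ⟨fun ⟨S, hS, _⟩ => hS ▸ S.2, fun h => ⟨⟨negSet v, h⟩, rfl, trivial⟩⟩

/-- Almost every Gaussian vector has non-zero entries with pairwise distinct absolute values. -/
theorem ae_gaussian_generic {σ : ℝ} (hσ : 0 < σ) (n : ℕ) :
    ∀ᵐ v ∂Measure.pi fun _ : Fin n => gaussianReal 1 (Real.toNNReal (σ ^ 2)),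
      (∀ i, v i ≠ 0) ∧ Function.Injective fun i => |v i| := by
  have hv := toNNReal_sq_ne_zero hσ
  have hac : (Measure.pi fun _ : Fin n => gaussianReal 1 (Real.toNNReal (σ ^ 2))) ≪ volume := by
    rw [gaussianReal_of_var_ne_zero _ hv]
    have := pi_withDensity_ofReal (ι := Fin n)
      (integrable_gaussianPDFReal 1 (Real.toNNReal (σ ^ 2)))
      (gaussianPDFReal_nonneg 1 (Real.toNNReal (σ ^ 2)))
    exact this ▸ withDensity_absolutelyContinuous _ _
  exact hac.ae_le (ae_ne_zero.and ae_injective_abs)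

/-- The law of the aligned output of the channel. -/
theorem map_alignedOutput_channel {Ω : Type*} [MeasurableSpace Ω] {P : Measure Ω}
    [IsProbabilityMeasure P] {n : ℕ} {σ : ℝ} {C : Fin n → Ω → ZMod 2}
    (hC : ∀ i, Measurable (C i)) {Z : Fin n → Ω → ℝ}
    (hZ : ∀ i, HasLaw (Z i) (gaussianReal 0 (Real.toNNReal (σ ^ 2))) P)
    (hZindep : iIndepFun Z P) (hCZ : IndepFun (fun ω i => C i ω) (fun ω i => Z i ω) P) :
    AEMeasurable (fun ω => alignedOutput (fun i => C i ω) fun i => Z i ω) P ∧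
    P.map (fun ω => alignedOutput (fun i => C i ω) fun i => Z i ω) =
      Measure.pi fun _ : Fin n => gaussianReal 1 (Real.toNNReal (σ ^ 2)) := by
  have hCm : AEMeasurable (fun ω i => C i ω) P := (measurable_pi_lambda _ hC).aemeasurable
  have hZm : AEMeasurable (fun ω i => Z i ω) P :=
    aemeasurable_pi_lambda _ fun i => (hZ i).aemeasurable
  have hpair : AEMeasurable (fun ω => ((fun i => C i ω), fun i => Z i ω)) P := hCm.prodMk hZm
  have hprob : IsProbabilityMeasure (P.map fun ω i => C i ω) := Measure.isProbabilityMeasure_map hCm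
  have hjoint := (indepFun_iff_map_prod_eq_prod_map_map hCm hZm).1 hCZ
  have hZlaw := (iIndepFun_iff_map_fun_eq_pi_map fun i => (hZ i).aemeasurable).1 hZindep
  simp only [(hZ _).map_eq] at hZlaw
  rw [hZlaw] at hjoint
  refine ⟨(measurable_alignedOutput n).comp_aemeasurable hpair, ?_⟩
  rw [← map_alignedOutput σ (P.map fun ω i => C i ω), ← hjoint,
    AEMeasurable.map_map_of_aemeasurable (measurable_alignedOutput n).aemeasurable hpair]
  rfl

end ChaseOS

end

/-! ### The conditional probability as a ratio of Gaussian measures -/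

theorem mainTheorem3 {Ω : Type*} [MeasurableSpace Ω] (P : MeasureTheory.Measure Ω)
    [MeasureTheory.IsProbabilityMeasure P] (n t q : ℕ) (σ : ℝ) (hσ : 0 < σ)
    -- the transmitted word and the independent Gaussian noise
    (C : Fin n → Ω → ZMod 2) (hC : ∀ i, Measurable (C i))
    (Z : Fin n → Ω → ℝ)
    (hZ : ∀ i, ProbabilityTheory.HasLaw (Z i)
      (ProbabilityTheory.gaussianReal 0 (Real.toNNReal (σ ^ 2))) P)
    (hZindep : ProbabilityTheory.iIndepFun Z P)
    (hCZ : ProbabilityTheory.IndepFun (fun ω i => C i ω) (fun ω i => Z i ω) P)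
    -- the error vector of the received word, sorted by reliability
    (e : Ω → Fin n → ZMod 2)
    (he : ∀ ω, e ω = ChaseOS.errorVector σ (fun i => C i ω)
      (ChaseOS.channelOutput (fun i => C i ω) (fun i => Z i ω)))
    -- the pattern
    (ρ : Fin n → ZMod 2) (hρ : ρ ∈ ChaseOS.logisticPatterns n q) (hρ0 : ρ ≠ 0)
    (w b : ℕ) (hw : w = hammingNorm ρ) (hb : b = t + w) (hbn : b ≤ n) :
    0 < P {ω | hammingNorm (e ω) = b} ∧
    MeasureTheory.IntegrableOn
      (fun p : (ChaseOS.betaIdx ρ b → ℝ) × (ChaseOS.gammaIdx ρ (n - b) → ℝ) =>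
        ChaseOS.jointOSDensity (ChaseOS.fe σ) (ChaseOS.Fe σ) b (ChaseOS.betaIdx ρ b) p.1 *
        ChaseOS.jointOSDensity (ChaseOS.fc σ) (ChaseOS.Fc σ) (n - b)
          (ChaseOS.gammaIdx ρ (n - b)) p.2)
      (ChaseOS.region ρ b (n - b)) ∧
    (ProbabilityTheory.cond P {ω | hammingNorm (e ω) = b}).real
        {ω | ∀ i : Fin n, (i : ℕ) + 1 ≤ ChaseOS.maxPos ρ → e ω i = ρ i} =
      ∫ p in ChaseOS.region ρ b (n - b),
        ChaseOS.jointOSDensity (ChaseOS.fe σ) (ChaseOS.Fe σ) b (ChaseOS.betaIdx ρ b) p.1 *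
        ChaseOS.jointOSDensity (ChaseOS.fc σ) (ChaseOS.Fc σ) (n - b)
          (ChaseOS.gammaIdx ρ (n - b)) p.2 := by
  open ChaseOS in
  have hprob1 := (hasDensityCDF_truncLaw hσ (-1)).prob
  have hprob2 := (hasDensityCDF_truncLaw hσ 1).prob
  have hrel : IsProbabilityMeasure (relLaw σ b (n - b)) := by unfold relLaw; infer_instance
  set V : Ω → Fin n → ℝ := fun ω => alignedOutput (fun i => C i ω) fun i => Z i ω
  obtain ⟨hVm, hVmap⟩ := map_alignedOutput_channel hC hZ hZindep hCZ
  have hgen : ∀ᵐ ω ∂P, (∀ i, V ω i ≠ 0) ∧ Function.Injective fun i => |V ω i| :=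
    ae_of_ae_map hVm (hVmap ▸ ae_gaussian_generic hσ n)
  set R := region ρ b (n - b)
  set A := chosenStats ρ b (n - b) ⁻¹' R
  have hR : MeasurableSet R := measurableSet_region ρ b (n - b)
  have hA : MeasurableSet A := measurable_chosenStats ρ b (n - b) hR
  -- The binomial probability of weight `b`. It is also the common factor of all events of weight
  -- `b`, and cancels in the conditional probability.
  set r : ENNReal := n.choose b *
    (ENNReal.ofReal (tailQ σ 1) ^ b * ENNReal.ofReal (1 - tailQ σ 1) ^ (n - b))
  have hr0 : r ≠ 0 := by
    have h1 : ENNReal.ofReal (tailQ σ 1) ≠ 0 := (ENNReal.ofReal_pos.2 (tailQ_pos hσ 1)).ne'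
    have h2 : ENNReal.ofReal (1 - tailQ σ 1) ≠ 0 := by
      rw [← tailQ_neg hσ]
      exact (ENNReal.ofReal_pos.2 (tailQ_pos hσ _)).ne'
    exact mul_ne_zero (by exact_mod_cast (Nat.choose_pos hbn).ne')
      (mul_ne_zero (pow_ne_zero _ h1) (pow_ne_zero _ h2))
  have hrtop : r ≠ ⊤ := ENNReal.mul_ne_top (ENNReal.natCast_ne_top _)
    (ENNReal.mul_ne_top (ENNReal.pow_ne_top ENNReal.ofReal_ne_top)
      (ENNReal.pow_ne_top ENNReal.ofReal_ne_top))
  have hPV : ∀ B : Set ((Fin b → ℝ) × (Fin (n - b) → ℝ)), MeasurableSet B →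
      P (V ⁻¹' splitEvent B) = r * relLaw σ b (n - b) B := fun B hB => by
    rw [← Measure.map_apply_of_aemeasurable hVm (measurableSet_splitEvent hB), hVmap,
      gaussian_measure_splitEvent hσ hB]
  have herr : ∀ ω, (∀ i, V ω i ≠ 0) → ∀ k, e ω k = if V ω (Tuple.sort (reliability σ
      (channelOutput (fun i => C i ω) fun i => Z i ω)) k) < 0 then 1 else 0 := fun ω hω k => by
    rw [he ω]
    exact errorVector_apply σ _ _ hω k
  set E := {ω | hammingNorm (e ω) = b}
  set M := {ω | ∀ i : Fin n, (i : ℕ) + 1 ≤ maxPos ρ → e ω i = ρ i}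
  have hE : E =ᵐ[P] V ⁻¹' splitEvent (b := b) Set.univ := by
    filter_upwards [hgen] with ω hω
    refine propext (Iff.trans ?_ mem_splitEvent_univ_iff.symm)
    rw [← hammingNorm_eq_card_negSet _ (herr ω hω.1)]
    rfl
  have hEM : (M ∩ E : Set Ω) =ᵐ[P] V ⁻¹' splitEvent A := by
    filter_upwards [hgen] with ω hω
    refine propext (Iff.trans ?_ (mem_splitEvent_region_iff hω.2
      (monotone_abs_alignedOutput hσ (fun i => C i ω) fun i => Z i ω) (herr ω hω.1) hρ0
      (by omega)).symm)
    exact and_comm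
  have hPE : P E = r := by
    rw [measure_congr hE, hPV _ MeasurableSet.univ, measure_univ, mul_one]
  -- The noise is only almost everywhere measurable, so the event is known to be measurable only up
  -- to a null set.
  have hEnull : NullMeasurableSet E P := by
    refine NullMeasurableSet.congr ?_ hE.symm
    exact hVm.nullMeasurableSet_preimage (measurableSet_splitEvent MeasurableSet.univ)
  set g : (betaIdx ρ b → ℝ) × (gammaIdx ρ (n - b) → ℝ) → ℝ := fun p =>
    jointOSDensity (fe σ) (Fe σ) b (betaIdx ρ b) p.1 *
      jointOSDensity (fc σ) (Fc σ) (n - b) (gammaIdx ρ (n - b)) p.2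
  have hcond : (ProbabilityTheory.cond P E) M = ∫⁻ p in R, ENNReal.ofReal (g p) := by
    rw [ProbabilityTheory.cond, Measure.smul_apply, Measure.restrict_apply₀' hEnull,
      measure_congr hEM, hPV A hA, hPE, smul_eq_mul, ← mul_assoc, ENNReal.inv_mul_cancel hr0 hrtop,
      one_mul, ← Measure.map_apply (measurable_chosenStats ρ b (n - b)) hR, map_chosenStats hσ,
      withDensity_apply _ hR]
  have hgm : Measurable g := by
    have h1 := (hasDensityCDF_truncLaw hσ (-1)).measurable_jointOSDensity b (betaIdx ρ b)
    have h2 := (hasDensityCDF_truncLaw hσ 1).measurable_jointOSDensity (n - b) (gammaIdx ρ (n - b))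
    rw [← fe_eq, ← Fe_eq] at h1
    rw [← fc_eq hσ, ← Fc_eq hσ] at h2
    exact (h1.comp measurable_fst).mul (h2.comp measurable_snd)
  have hg0 : ∀ p, 0 ≤ g p := fun p => by
    have h1 := (hasDensityCDF_truncLaw hσ (-1)).jointOSDensity_nonneg b (betaIdx ρ b) p.1
    have h2 := (hasDensityCDF_truncLaw hσ 1).jointOSDensity_nonneg (n - b) (gammaIdx ρ (n - b)) p.2
    rw [← fe_eq, ← Fe_eq] at h1
    rw [← fc_eq hσ, ← Fc_eq hσ] at h2
    exact mul_nonneg h1 h2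
  refine ⟨hPE ▸ pos_iff_ne_zero.2 hr0, ⟨hgm.aestronglyMeasurable, ?_⟩, ?_⟩
  -- The integral of the non-negative integrand has already been identified with a conditional
  -- probability, hence it is finite.
  · rw [hasFiniteIntegral_iff_ofReal (Filter.Eventually.of_forall hg0), ← hcond]
    have : IsProbabilityMeasure (ProbabilityTheory.cond P E) :=
      ProbabilityTheory.cond_isProbabilityMeasure (hPE ▸ hr0)
    exact measure_lt_top _ _
  · rw [integral_eq_lintegral_of_nonneg_ae (Filter.Eventually.of_forall hg0)
      hgm.aestronglyMeasurable, ← hcond]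
    rfl
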